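/- Let $(X,d)$ be a metric space in which any two points are joined by a shortest path (one such path being fixed for each ordered pair of points), and let $o\in X$ be the origin. In the online metric TSP, a request $(x,r)$, $x\in X$, $r\ge 0$, becomes known at time $r$; a server that is in $o$ at time $0$ and moves at most at unit speed has to visit the point $x$ of every request at some time $\ge r$ and to return to $o$. The makespan is the first time at which it is in $o$ and has served all requests; the server is told when this happens. For a finite set $R$ of requests let $C^*$ be the optimal offline makespan. An online algorithm decides, at time $0$ and at each release, from the requests released so far, which finite list of points (with waiting times) to visit next; it is $\rho$-competitive if its makespan is always at most $\rho\, C^*$. Let $\hat R$ be a finite set of predicted requests. For a set $R'$ of requests and a request $(x',r')$ let $\gamma(R',(x',r'))$ be the optimal makespan, counted from $r'$, for serving $R'$ and returning when starting in $x'$ at time $r'$. For sets $A,B$ of requests and $k\in\mathbb N\cup\{\infty\}$ let $\Gamma_k(A,B)$ be the minimum of $\sum_{(A',b)\in\mathcal H}\gamma(A',b)$ over all finite sets $\mathcal H$ of pairs $(A',b)$ with $A'\subseteq A$, $|A'|\le k$, $b\in B$ such that every element of $A$ lies in some such $A'$ ($\infty$ if there is no such $\mathcal H$). Let $\Lambda_1=\Gamma_\infty(\hat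 R,R)+\Gamma_1(R,\hat R)$. Let $\mathcal T$ be a polynomial-time $\nu$-approximation algorithm for metric TSP (closed tours), $\nu\ge1$, let $\mathcal A$ be a polynomial-time $\rho$-competitive online algorithm, and let $\alpha>0$. For a set $U$ of requests, the tour through $U$ from the current position visits the points of $U$ in the order in which $\mathcal T$ arranges them in a closed tour with $o$, waits at each point until its requests in $U$ are released, and ends in $o$. Let $\tilde C$ be the time at which the tour through $\hat R$, started in $o$ at time $0$, is completed. Polynomial-time AlgoGen works as follows, $p(t)$ being the position of the server at time $t$. (i) Follow $\mathcal A$ as long as $t\le\alpha\tilde C-d(p(t),o)$. (ii) Move to $o$. (iii) From time $\alpha\tilde C$ on, follow the tour through $\hat R$. Whenever a request $q=(x,r)\in R\setminus\hat R$ is released (and, at the beginning of phase (iii), one after the other for every $q\in R\setminus\hat R$ that has been released but not served), choose $\hat q=(\hat x,\hat r)\in\hat R$ that minimizes $\gamma(\{q\},\hat q)$. If $\hat q$ is part of the current remaining tour, let $T_1$ be this tour extended by an excursion that starts in $\hat x$ when $\hat q$ is first visited, serves $q$ and returns to $\hat x$; otherwise let $T_1$ be the remaining tour extended by an immediate deviation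 from the current position to $x$ and back. Let $T_2$ be the tour, from the current position, through all unserved requests, predicted or taken into account so far, including $q$. Follow the tour among $T_1,T_2$ that is completed first ($T_2$ if $\hat R=\emptyset$). Then polynomial-time AlgoGen is an online algorithm, and for all $R$ and $\hat R$ its makespan is at most \[ \min\left\{(1+\nu)(1+\alpha)\left(1+\frac{3\,\Lambda_1}{2\,C^*}\right),\ \rho+(1+\nu)\left(1+\frac{\rho}{\alpha}\right)\right\}\cdot C^* , \] where $\Lambda_1/C^*$ is read as $0$ or $\infty$ if $C^*=0$ (in that case the makespan is $0$). Moreover, the total number of elementary operations in all its computations is bounded by a polynomial in $|R|+|\hat R|$; here polynomial time refers to a real RAM with unit-cost arithmetic and comparisons of real numbers and unit-cost access to the metric and the shortest paths, and the server observes the time, its position, its remaining tour and which requests are unserved. -/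

import Mathlib

open scoped NNReal ENNReal

noncomputable section

namespace OLTSP

/-! ## Metric spaces in which a server can move at unit speed -/

/-- A choice of a shortest path between any two points of a metric space: `path x y s` is the
point at distance `s` from `x` on the path from `x` to `y`. -/
structure ShortestPaths (X : Type) [MetricSpace X] where
  path : X → X → ℝ → X
  path_zero : ∀ x y, path x y 0 = x
  path_dist : ∀ x y, path x y (dist x y) = y
  dist_path : ∀ x y s s', 0 ≤ s → s ≤ s' → s' ≤ dist x y →
    dist (path x y s) (path x y s') = s' - s

/-- A request: a point and a release date. The same type is used for the stops of a plan: the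
stop `(x, w)` means "go to `x` and stay there at least until time `w`". -/
abbrev Req (X : Type) : Type := X × ℝ

section Offline

variable {X : Type} [MetricSpace X]

/-! ## Offline optimum, cover error -/

/-- The request `q` is served within `[a, b]` by a server moving along `p`. -/
def ServedIn (p : ℝ → X) (a b : ℝ) (q : Req X) : Prop :=
  ∃ s, a ≤ s ∧ s ≤ b ∧ q.2 ≤ s ∧ p s = q.1

/-- Optimal makespan (time needed, counted from the initial time) for serving the requests `S`
and returning, when the origin is `b.1` and the initial time is `b.2`. -/
def optMakespan (S : Finset (Req X)) (b : Req X) : ℝ≥0∞ :=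
  ⨅ T : {T : ℝ≥0 // ∃ p : ℝ → X, LipschitzWith 1 p ∧ p b.2 = b.1 ∧ p (b.2 + T) = b.1 ∧
    ∀ q ∈ S, ServedIn p b.2 (b.2 + T) q}, ((T : ℝ≥0) : ℝ≥0∞)

/-- `H` is a `k`-hyperedge cover of `A` by `B`. A hyperedge is a pair `(A', b)`. -/
def IsCover (k : ℕ∞) (A B : Finset (Req X)) (H : Finset (Finset (Req X) × Req X)) : Prop :=
  (∀ e ∈ H, e.1 ⊆ A ∧ (e.1.card : ℕ∞) ≤ k ∧ e.2 ∈ B) ∧ ∀ a ∈ A, ∃ e ∈ H, a ∈ e.1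

/-- `Γ_k(A, B)`, the minimum cost of a `k`-hyperedge cover of `A` by `B` (`∞` if there is none);
the cost of `(A', b)` is the optimal makespan for `A'` from origin `b.1` and initial time `b.2`. -/
def coverCost (k : ℕ∞) (A B : Finset (Req X)) : ℝ≥0∞ :=
  ⨅ H : {H : Finset (Finset (Req X) × Req X) // IsCover k A B H},
    ∑ e ∈ (H : Finset (Finset (Req X) × Req X)), optMakespan e.1 e.2

/-- The cover error `Λ_k(R, R')` of a prediction `R'` for the actual requests `R`. -/
def coverError (k : ℕ∞) (R R' : Finset (Req X)) : ℝ≥0∞ :=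
  coverCost ⊤ R' R + coverCost k R R'

open Classical in
/-- The set of requests in a list. -/
def reqSet (l : List (Req X)) : Finset (Req X) := l.toFinset

/-- A finite set of requests with non-negative release dates, listed in some order. -/
def IsReqSet (l : List (Req X)) : Prop := l.Nodup ∧ ∀ q ∈ l, 0 ≤ q.2

/-- An online instance: a finite set of requests, listed in an order of their release. -/
def IsInstance (l : List (Req X)) : Prop := IsReqSet l ∧ l.Pairwise (fun q q' => q.2 ≤ q'.2)

/-- Makespan of a server moving along `p`: the first time at which it is in the origin and has
served all requests (`∞` if there is no such time). -/
def makespan (o : X) (p : ℝ → X) (R : List (Req X)) : ℝ≥0∞ :=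
  ⨅ T : {T : ℝ≥0 // p T = o ∧ ∀ q ∈ R, ServedIn p 0 T q}, ((T : ℝ≥0) : ℝ≥0∞)

/-! ## Metric TSP without release dates -/

/-- Length of a walk from `x` through `l` to `y`. -/
def walkLength (y : X) : X → List X → ℝ
  | x, [] => dist x y
  | x, z :: l => dist x z + walkLength y z l

/-- `tsp (s, l)` orders the points `l` such that the closed tour that starts in `s`, visits them
in this order and returns to `s` is at most `ν` times as long as a shortest closed tour. -/
def IsTSPApprox (ν : ℝ≥0) (tsp : X × List X → List X) : Prop :=
  ∀ s l, (tsp (s, l)).Perm l ∧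
    ∀ l' : List X, l'.Perm l → walkLength s s (tsp (s, l)) ≤ ν * walkLength s s l'

end Offline

/-! ## Plans and their execution -/

section Plans

variable {X : Type} [MetricSpace X] (geo : ShortestPaths X)

/-- Position at time `t` of a server that is in `x` at time `t₀` and follows a list of stops. -/
def planPos : X → ℝ → List (Req X) → ℝ → X
  | x, _, [], _ => x
  | x, t₀, (y, w) :: l, t =>
    if t < t₀ + dist x y then geo.path x y (t - t₀)
    else if t < max (t₀ + dist x y) w then y
    else planPos y (max (t₀ + dist x y) w) l t

/-- The stops that have not yet been completed at time `t`. -/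
def planRest : X → ℝ → List (Req X) → ℝ → List (Req X)
  | _, _, [], _ => []
  | x, t₀, (y, w) :: l, t =>
    if t < max (t₀ + dist x y) w then (y, w) :: l
    else planRest y (max (t₀ + dist x y) w) l t

/-- The time at which a list of stops is completed. -/
def planEnd : X → ℝ → List (Req X) → ℝ
  | _, t₀, [] => t₀
  | x, t₀, (y, w) :: l => planEnd y (max (t₀ + dist x y) w) l

/-- Move along `p` until time `t`, and follow the list of stops `l` from then on. -/
def splice (p : ℝ → X) (t : ℝ) (l : List (Req X)) : ℝ → X :=
  fun s => if s ≤ t then p s else planPos geo (p t) t l s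

/-! ## Online algorithms -/

/-- Auxiliary recursion for `onlinePos`: so far, the requests `pre` have been released, the last
decision is due at time `t`, and the server has moved along `p` up to then. -/
def onlineRun (A : List (Req X) → List (Req X)) :
    (ℝ → X) → ℝ → List (Req X) → List (Req X) → ℝ → X
  | p, t, pre, [] => splice geo p t (A pre)
  | p, t, pre, q :: R => onlineRun A (splice geo p t (A pre)) q.2 (pre ++ [q]) R

/-- The trajectory of an online algorithm. The algorithm is given by its decisions: at time `0` and
whenever a request is released, it maps the list of the requests released so far to the stops that
the server is going to follow until the next request is released. -/
def onlinePos (o : X) (A : List (Req X) → List (Req X)) (R : List (Req X)) : ℝ → X :=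
  onlineRun geo A (fun _ => o) 0 [] R

/-- The online algorithm `A` (without predictions) is `ρ`-competitive. -/
def IsCompetitive (o : X) (ρ : ℝ≥0) (A : List (Req X) → List (Req X)) : Prop :=
  ∀ R, IsInstance R → makespan o (onlinePos geo o A R) R ≤ ρ * optMakespan (reqSet R) (o, 0)

/-! ## The polynomial-time algorithm with predictions -/

open Classical in
/-- The tour through the requests `U` to the origin: ask for a TSP tour on the points of `U` and the
origin, visit the points in this order, and wait in every point for the release of its requests. -/
def tour (o : X) (tsp : X × List X → List X) (U : List (Req X)) : List (Req X) :=
  (tsp (o, U.map Prod.fst)).flatMap (fun x => U.filter (fun q => q.1 = x)) ++ [(o, 0)]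

/-- Length of the tour through the predicted requests, started in the origin at time `0`. -/
def tourLength (o : X) (tsp : X × List X → List X) (U : List (Req X)) : ℝ :=
  planEnd o 0 (tour o tsp U)

/-- The cost of the hyperedge that covers the request `q` by `h`, that is, the optimal makespan for
`{q}` from origin `h.1` and initial time `h.2` (see `optMakespan_singleton`). -/
def excursionCost (q h : Req X) : ℝ := max (dist h.1 q.1) (q.2 - h.2) + dist q.1 h.1

/-- `excursionCost` is the cost of the hyperedge with the single covered request `q`. -/
theorem optMakespan_singleton (geo : ShortestPaths X) (q h : Req X) :
    optMakespan {q} h = ENNReal.ofReal (excursionCost q h) := by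
  have hc : 0 ≤ excursionCost q h := by unfold excursionCost; positivity
  apply le_antisymm
  · set d := dist h.1 q.1 with hd
    set T := excursionCost q h with hT
    have hT' : T = max d (q.2 - h.2) + d := by
      rw [hT, excursionCost, dist_comm q.1 h.1]
    have hd0 : 0 ≤ d := dist_nonneg
    have hm1 : d ≤ max d (q.2 - h.2) := le_max_left _ _
    have hm2 : q.2 - h.2 ≤ max d (q.2 - h.2) := le_max_right _ _
    let u : ℝ → ℝ := fun s => max 0 (min (min (s - h.2) d) (h.2 + T - s))
    have hu0 : ∀ s, 0 ≤ u s := fun s => le_max_left _ _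
    have hud : ∀ s, u s ≤ d := fun s =>
      max_le hd0 ((min_le_left _ _).trans (min_le_right _ _))
    have hul : ∀ s s', s ≤ s' → |u s - u s'| ≤ s' - s := by
      intro s s' hs
      simp only [u]
      rw [abs_le]
      constructor <;>
      · rcases max_cases 0 (min (min (s - h.2) d) (h.2 + T - s)) with h1 | h1 <;>
        rcases max_cases 0 (min (min (s' - h.2) d) (h.2 + T - s')) with h2 | h2 <;>
        rcases min_cases (min (s - h.2) d) (h.2 + T - s) with h3 | h3 <;>
        rcases min_cases (min (s' - h.2) d) (h.2 + T - s') with h4 | h4 <;>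
        rcases min_cases (s - h.2) d with h5 | h5 <;>
        rcases min_cases (s' - h.2) d with h6 | h6 <;> linarith [h1.1, h2.1]
    have hpd : ∀ a b, 0 ≤ a → 0 ≤ b → a ≤ d → b ≤ d →
        dist (geo.path h.1 q.1 a) (geo.path h.1 q.1 b) = |a - b| := by
      intro a b ha hb ha' hb'
      rcases le_total a b with hab | hab
      · rw [geo.dist_path _ _ _ _ ha hab hb', abs_sub_comm, abs_of_nonneg (by linarith)]
      · rw [dist_comm, geo.dist_path _ _ _ _ hb hab ha', abs_of_nonneg (by linarith)]
    refine iInf_le_of_le ⟨⟨T, hc⟩, fun s => geo.path h.1 q.1 (u s), ?_, ?_, ?_, ?_⟩ ?_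
    · refine LipschitzWith.of_dist_le_mul fun s s' => ?_
      rw [hpd _ _ (hu0 _) (hu0 _) (hud _) (hud _), Real.dist_eq, NNReal.coe_one, one_mul]
      rcases le_total s s' with hs | hs
      · exact (hul s s' hs).trans (by rw [abs_sub_comm]; exact le_abs_self _)
      · rw [abs_sub_comm]; exact (hul s' s hs).trans (le_abs_self _)
    · have : u h.2 = 0 := by
        simp only [u, sub_self]
        exact max_eq_left ((min_le_left _ _).trans (min_le_left _ _))
      simp only [this, geo.path_zero]
    · have : u (h.2 + T) = 0 := by
        simp only [u, sub_self]
        exact max_eq_left (min_le_right _ _)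
      change geo.path h.1 q.1 (u (h.2 + T)) = h.1
      rw [this, geo.path_zero]
    · intro q' hq'
      rw [Finset.mem_singleton] at hq'
      subst hq'
      change ServedIn _ h.2 (h.2 + T) q'
      refine ⟨h.2 + max d (q'.2 - h.2), by linarith, by linarith, by linarith, ?_⟩
      have : u (h.2 + max d (q'.2 - h.2)) = d := by
        simp only [u]
        rw [min_eq_right (a := h.2 + max d (q'.2 - h.2) - h.2) (b := d) (by linarith),
          min_eq_left (by linarith), max_eq_right hd0]
      change geo.path h.1 q'.1 (u (h.2 + max d (q'.2 - h.2))) = q'.1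
      rw [this, hd, geo.path_dist]
    · rw [ENNReal.ofReal, Real.toNNReal_of_nonneg hc]
      exact le_rfl
  · refine le_iInf ?_
    rintro ⟨T, p, hp, h0, h1, hs⟩
    obtain ⟨s, hs1, hs2, hs3, hs4⟩ := hs q (Finset.mem_singleton_self q)
    refine ENNReal.ofReal_le_of_le_toReal ?_
    have e1 := hp.dist_le_mul h.2 s
    have e2 := hp.dist_le_mul s (h.2 + T)
    rw [h0, hs4, Real.dist_eq, abs_sub_comm, abs_of_nonneg (by linarith)] at e1
    rw [h1, hs4, Real.dist_eq, abs_sub_comm, abs_of_nonneg (by linarith)] at e2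
    simp only [NNReal.coe_one, one_mul] at e1 e2
    have e3 : max (dist h.1 q.1) (q.2 - h.2) ≤ s - h.2 := max_le e1 (by linarith)
    simp only [ENNReal.coe_toReal, excursionCost]
    linarith

open Classical in
/-- Insert, after the first visit of `h`, an excursion that serves `q` and returns to `h`. -/
def insertExcursion (h q : Req X) : List (Req X) → List (Req X)
  | [] => []
  | s :: l => if s = h then h :: q :: h :: l else s :: insertExcursion h q l

/-- What the server knows when an unexpected request has to be inserted. -/
structure Situation (X : Type) where
  /-- the predicted requests -/
  pred : List (Req X)
  /-- the unserved requests, predicted or released, including the new one -/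
  unserved : List (Req X)
  /-- the remaining stops of the current tour -/
  rest : List (Req X)
  /-- the current time -/
  now : ℝ
  /-- the current position -/
  pos : X
  /-- the new unexpected request -/
  new : Req X

open Classical in
/-- The reaction to an unexpected request `q`. Let `h` be a predicted request that covers `q` at
minimum cost. The tour `T₁` extends the current tour by an excursion from `h` if `h` is part of
it, and by an immediate deviation from the current position otherwise. The tour `T₂` leads from
the current position through all unserved requests. The shorter one is chosen. -/
def replan (o : X) (tsp : X × List X → List X) (c : Situation X) : List (Req X) :=
  match c.pred.argmin (excursionCost c.new) with
  | none => tour o tsp c.unserved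
  | some h =>
    let T₁ := if h ∈ c.rest then insertExcursion h c.new c.rest
      else c.new :: (c.pos, 0) :: c.rest
    let T₂ := tour o tsp c.unserved
    if planEnd c.pos c.now T₁ ≤ planEnd c.pos c.now T₂ then T₁ else T₂

open Classical in
/-- Phase (iii). At time `t` the server has moved along `p`, follows the stops `l` and has taken
account of the unexpected requests `seen`; the unexpected requests in the last argument have to be
inserted, each one when it is released or, if this is in the past, immediately. The result is the
trajectory and the list of all situations in which `replan` has been called. -/
def predictReplan (o : X) (tsp : X × List X → List X) (pred : List (Req X)) :
    (ℝ → X) → ℝ → List (Req X) → List (Req X) → List (Req X) → (ℝ → X) × List (Situation X)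
  | p, t, l, _, [] => (splice geo p t l, [])
  | p, t, l, seen, q :: R =>
    let p' := splice geo p t l
    let t' := max t q.2
    let c : Situation X :=
      { pred := pred
        unserved := (pred ++ seen).filter (fun u => ¬ ServedIn p' 0 t' u) ++ [q]
        rest := planRest (p t) t l t'
        now := t'
        pos := p' t'
        new := q }
    let res := predictReplan o tsp pred p' t' (replan o tsp c) (seen ++ [q]) R
    (res.1, c :: res.2)

/-- End of phase (i), in which the server moves along `p`, for a time budget `B`: the last time `t`
with `t ≤ B - d(p(t), o)`. -/
def phaseOneEnd (o : X) (p : ℝ → X) (B : ℝ) : ℝ := sSup {t | 0 ≤ t ∧ t ≤ B - dist (p t) o}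

open Classical in
/-- The polynomial-time learning-augmented algorithm for the prediction `pred` and the actual
requests `R`, with its trajectory and the list of all situations in which `replan` is called.
Phases (i) and (ii) end at time `B`, when the server is in the origin. -/
def algoGen (o : X) (tsp : X × List X → List X) (A : List (Req X) → List (Req X)) (α : ℝ≥0)
    (pred R : List (Req X)) : (ℝ → X) × List (Situation X) :=
  let B : ℝ := α * tourLength o tsp pred
  let pA := onlinePos geo o A R
  let p₂ := splice geo pA (phaseOneEnd o pA B) [(o, 0)]
  predictReplan geo o tsp pred p₂ B (tour o tsp pred) []
    (R.filter (fun q => q ∉ pred ∧ ¬ ServedIn p₂ 0 B q))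

/-- `F` is the trajectory map of an online algorithm: the server starts in the origin, moves at most
at unit speed, and its position at time `t` does not depend on requests released after `t`. -/
def IsOnline (o : X) (F : List (Req X) → ℝ → X) : Prop :=
  (∀ R, IsInstance R → F R 0 = o ∧ LipschitzWith 1 (F R)) ∧
  ∀ R R' t, IsInstance (R ++ R') → (∀ q ∈ R', t < q.2) → F (R ++ R') t = F R t

/-! ## Running time

Programs of a real RAM with access to the metric space. All operations have unit cost. -/

/-- Number of steps of a loop over a list, with body `f` that takes `c` steps. -/
def foldCost {α β : Type} (f : β × α → β) (c : β × α → ℕ) : β → List α → ℕ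
  | _, [] => 1
  | b, a :: l => c (b, a) + 1 + foldCost f c (f (b, a)) l

open Classical in
/-- `Computes geo f c`: there is a program that maps every input `x` to `f x` in `c x` steps. The
elementary operations are arithmetic and comparison of real numbers, evaluation of the metric and
of points on shortest paths, and the basic operations on pairs and lists; they are combined by
composition, case distinction, and loops over lists. -/
inductive Computes : {α β : Type} → (α → β) → (α → ℕ) → Prop
  | id {α : Type} : Computes (fun x : α => x) (fun _ => 1)
  | unit {α : Type} : Computes (fun _ : α => ()) (fun _ => 1)
  | bool {α : Type} (b : Bool) : Computes (fun _ : α => b) (fun _ => 1)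
  | real {α : Type} (r : ℝ) : Computes (fun _ : α => r) (fun _ => 1)
  | point {α : Type} (x : X) : Computes (fun _ : α => x) (fun _ => 1)
  | add : Computes (fun z : ℝ × ℝ => z.1 + z.2) (fun _ => 1)
  | sub : Computes (fun z : ℝ × ℝ => z.1 - z.2) (fun _ => 1)
  | mul : Computes (fun z : ℝ × ℝ => z.1 * z.2) (fun _ => 1)
  | div : Computes (fun z : ℝ × ℝ => z.1 / z.2) (fun _ => 1)
  | le : Computes (fun z : ℝ × ℝ => decide (z.1 ≤ z.2)) (fun _ => 1)
  | metric : Computes (fun z : X × X => dist z.1 z.2) (fun _ => 1)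
  | walk : Computes (fun z : X × X × ℝ => geo.path z.1 z.2.1 z.2.2) (fun _ => 1)
  | fst {α β : Type} : Computes (fun z : α × β => z.1) (fun _ => 1)
  | snd {α β : Type} : Computes (fun z : α × β => z.2) (fun _ => 1)
  | pair {α β γ : Type} {f : α → β} {g : α → γ} {c d : α → ℕ} :
      Computes f c → Computes g d → Computes (fun x => (f x, g x)) (fun x => c x + d x + 1)
  | comp {α β γ : Type} {f : α → β} {g : β → γ} {c : α → ℕ} {d : β → ℕ} :
      Computes f c → Computes g d → Computes (fun x => g (f x)) (fun x => c x + d (f x) + 1)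
  | nil {α β : Type} : Computes (fun _ : α => ([] : List β)) (fun _ => 1)
  | cons {α : Type} : Computes (fun z : α × List α => z.1 :: z.2) (fun _ => 1)
  | listCase {α β γ : Type} {f : α → γ} {g : α × β × List β → γ} {c : α → ℕ}
      {d : α × β × List β → ℕ} :
      Computes f c → Computes g d →
      Computes
        (fun z : α × List β => match z.2 with | [] => f z.1 | b :: l => g (z.1, b, l))
        (fun z : α × List β => (match z.2 with | [] => c z.1 | b :: l => d (z.1, b, l)) + 1)
  | cond {α β : Type} {b : α → Bool} {f g : α → β} {e c d : α → ℕ} :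
      Computes b e → Computes f c → Computes g d →
      Computes (fun x => if b x then f x else g x)
        (fun x => e x + (if b x then c x else d x) + 1)
  | fold {α β : Type} {f : β × α → β} {c : β × α → ℕ} :
      Computes f c →
      Computes (fun z : β × List α => z.2.foldl (fun b a => f (b, a)) z.1)
        (fun z : β × List α => foldCost f c z.1 z.2)

/-- `f` is computable in time polynomial in `size`. -/
def PolyTime {α β : Type} (size : α → ℕ) (f : α → β) : Prop :=
  ∃ c, Computes geo f c ∧ ∃ P : Polynomial ℕ, ∀ x, c x ≤ P.eval (size x)

/-- The data of a situation as an input of a program. -/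
def Situation.ofInput
    (z : List (Req X) × List (Req X) × List (Req X) × ℝ × X × Req X) : Situation X :=
  ⟨z.1, z.2.1, z.2.2.1, z.2.2.2.1, z.2.2.2.2.1, z.2.2.2.2.2⟩

/-- The data of a situation as an input of a program. -/
def Situation.toInput (c : Situation X) :
    List (Req X) × List (Req X) × List (Req X) × ℝ × X × Req X :=
  (c.pred, c.unserved, c.rest, c.now, c.pos, c.new)

open Classical in
/-- The learning-augmented algorithm runs in polynomial time: there are programs for its
subroutines, namely for the tour through the predicted requests and the time budget, for the
decisions of `A`, for the test whether a released request has been predicted, and for `replan`,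
such that the total number of steps of all calls is bounded by a polynomial in the number of
predicted and actual requests. -/
def AlgoGenPolyTime (o : X) (tsp : X × List X → List X) (A : List (Req X) → List (Req X))
    (α : ℝ≥0) : Prop :=
  ∃ (cTour : List (Req X) → ℕ) (cA : List (Req X) → ℕ) (cTest : Req X × List (Req X) → ℕ)
    (cReplan : List (Req X) × List (Req X) × List (Req X) × ℝ × X × Req X → ℕ),
    Computes geo (fun U => (tour o tsp U, (α : ℝ) * tourLength o tsp U)) cTour ∧
    Computes geo A cA ∧
    Computes geo (fun z : Req X × List (Req X) => decide (z.1 ∈ z.2)) cTest ∧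
    Computes geo (fun z => replan o tsp (Situation.ofInput z)) cReplan ∧
    ∃ P : Polynomial ℕ, ∀ pred R, IsReqSet pred → IsInstance R →
      let B : ℝ := α * tourLength o tsp pred
      let τ := phaseOneEnd o (onlinePos geo o A R) B
      cTour pred
        + ∑ k ∈ Finset.range ((R.filter (fun q => q.2 ≤ τ)).length + 1), cA (R.take k)
        + (R.map (fun q => cTest (q, pred))).sum
        + ((algoGen geo o tsp A α pred R).2.map (fun c => cReplan c.toInput)).sum
        ≤ P.eval (pred.length + R.length)

end Plans

end OLTSP

end

open scoped NNReal ENNReal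

noncomputable section

/-! Write `C` for the offline optimum, `D` for the length of the predicted tour and `B = αD` for the
time budget.

The basic estimate is `planEnd_tour_le`. A tour from `x` ends no later than one that first goes to
`o` and waits there until a time `M` by which all its requests are released. After that it takes at
most `ν` times the length of a shortest closed walk through its points (`coverWalk`). An offline
solution, sampled at its service times, is a closed walk (`coverWalk_le_optMakespan`), so `C` bounds
the walk through `R`.

Robustness. If `A` finishes within `B`, the algorithm finishes no later than `A`. Otherwise `B ≤
ρC`, so `D ≤ (ρ/α)C`. A closed walk of length at most `C + D` visits all predicted and actual
points, and all releases are at most `C + D`. When phase (iii) replans at a release time `r`, the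
server is within `r - B` of `o`, so `T₂` ends by `ρC + (1+ν)(C+D)`. The chosen tour is never worse
than `T₂`, so only the last replanning counts (`exists_finishes_le_of_tours`).

Smoothness. Let `g = Γ_∞(pred, R)` and `g₁ = Γ_1(R, pred)`. Attaching to an optimal tour for `R` the
closed tours of the hyperedges of a cover gives a closed walk of length `C + g` through all points
(`coverWalk_union_le_coverCost`). Predicted releases are at most `C + g` as well. Hence `D ≤
(1+ν)(C+g)`, and the tours considered at time `B` end by `(1+α)(1+ν)(C+g)`. Later, an unexpected
request `q` with covering request `h` prolongs the tour by at most twice the cost `γ` of covering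
it: an excursion from `h` costs at most `γ`, and if `h` has left the tour, the server is still
within `γ` of `q` (`exists_finishes_le_of_excursions`). These costs sum to at most `2 g₁`
(`sum_le_coverCost_one`), and `2 ≤ (1+ν)(1+α)` because `ν ≥ 1`. The argument even gives the constant
1 in place of 3/2.

The algorithm is online because each phase depends only on the past trajectory. It runs in
polynomial time because every replanning adds at most two stops or starts a new tour of at most
quadratic length. -/

namespace OLTSP

/-! ### Execution of lists of stops: positions, completion times, remaining stops -/

section PlanLemmas

variable {X : Type} [MetricSpace X] (geo : ShortestPaths X)

/-- The point in which a server ends up that starts in `x` and follows a list of stops. -/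
def planLast : X → List (Req X) → X
  | x, [] => x
  | _, (y, _) :: l => planLast y l

theorem dist_path_right {x y : X} {s : ℝ} (h₀ : 0 ≤ s) (h₁ : s ≤ dist x y) :
    dist (geo.path x y s) y = dist x y - s := by
  have := geo.dist_path x y s (dist x y) h₀ h₁ le_rfl
  rwa [geo.path_dist] at this

theorem le_planEnd (x : X) (t : ℝ) (l : List (Req X)) : t ≤ planEnd x t l := by
  induction l generalizing x t with
  | nil => exact le_rfl
  | cons a l ih =>
    exact le_trans (le_max_of_le_left (le_add_of_nonneg_right dist_nonneg)) (ih a.1 _)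

theorem planEnd_mono (x : X) {t t' : ℝ} (h : t ≤ t') (l : List (Req X)) :
    planEnd x t l ≤ planEnd x t' l := by
  induction l generalizing x t t' with
  | nil => exact h
  | cons a l ih => exact ih a.1 (max_le_max_right _ (by linarith))

/-- Waiting for a release can absorb part of a delay but never enlarges it. -/
theorem planEnd_add_le (x : X) (t : ℝ) {c : ℝ} (hc : 0 ≤ c) (l : List (Req X)) :
    planEnd x (t + c) l ≤ planEnd x t l + c := by
  induction l generalizing x t with
  | nil => exact le_rfl
  | cons a l ih =>
    refine (planEnd_mono a.1 (t' := max (t + dist x a.1) a.2 + c) ?_ l).trans (ih a.1 _)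
    have h₁ := le_max_left (t + dist x a.1) a.2
    have h₂ := le_max_right (t + dist x a.1) a.2
    exact max_le (by linarith) (by linarith)

/-- A detour via `y` before the first stop cannot help. With `y = o` this reduces tours from any
position to tours from the origin. -/
theorem planEnd_triangle (x y : X) (t : ℝ) (l : List (Req X)) :
    planEnd x t l ≤ planEnd y (t + dist x y) l := by
  cases l with
  | nil => exact le_add_of_nonneg_right dist_nonneg
  | cons a l =>
    refine planEnd_mono a.1 (max_le_max_right _ ?_) l
    linarith [dist_triangle x y a.1]

theorem planLast_append {X : Type} (x : X) (l l' : List (Req X)) :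
    planLast x (l ++ l') = planLast (planLast x l) l' := by
  induction l generalizing x with
  | nil => rfl
  | cons a l ih => exact ih a.1

/-- Resuming a plan at time `s` does not change when it ends. The maximum covers the case that it is
already over and the server has been idle. -/
theorem planEnd_planRest (x : X) {t s : ℝ} (hs : t ≤ s) (l : List (Req X)) :
    planEnd (planPos geo x t l s) s (planRest x t l s) = max s (planEnd x t l) := by
  induction l generalizing x t with
  | nil => simp [planEnd, planRest, hs]
  | cons a l ih =>
    obtain ⟨y, w⟩ := a
    simp only [planPos, planRest]
    by_cases h₂ : s < max (t + dist x y) w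
    · have h₃ : s ≤ planEnd x t ((y, w) :: l) := h₂.le.trans (le_planEnd y _ l)
      rw [if_pos h₂, if_pos h₂, max_eq_right h₃]
      by_cases h₁ : s < t + dist x y
      · rw [if_pos h₁]
        simp only [planEnd]
        rw [dist_path_right geo (by linarith) (by linarith)]
        congr 2
        ring
      -- The server is already waiting in `y`, so only `w` decides when it leaves.
      · rw [if_neg h₁]
        simp only [planEnd, dist_self, add_zero]
        have h₄ : t + dist x y ≤ s := not_lt.1 h₁
        have h₅ : s < w := (lt_max_iff.1 h₂).resolve_left h₁
        rw [max_eq_right h₅.le, max_eq_right (h₄.trans h₅.le)]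
    · have h₁ : ¬ s < t + dist x y := fun h => h₂ (lt_max_of_lt_left h)
      rw [if_neg h₁, if_neg h₂, if_neg h₂]
      exact ih y (not_lt.1 h₂)

theorem planLast_planRest (x : X) {t s : ℝ} (l : List (Req X)) :
    planLast (planPos geo x t l s) (planRest x t l s) = planLast x l := by
  induction l generalizing x t with
  | nil => rfl
  | cons a l ih =>
    obtain ⟨y, w⟩ := a
    simp only [planPos, planRest]
    by_cases h₂ : s < max (t + dist x y) w
    · rw [if_pos h₂, if_pos h₂]; rfl
    · have h₁ : ¬ s < t + dist x y := fun h => h₂ (lt_max_of_lt_left h)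
      rw [if_neg h₁, if_neg h₂, if_neg h₂]
      exact ih y

theorem planPos_of_planEnd_le (x : X) {t s : ℝ} (l : List (Req X)) (h : planEnd x t l ≤ s) :
    planPos geo x t l s = planLast x l := by
  induction l generalizing x t with
  | nil => rfl
  | cons a l ih =>
    obtain ⟨y, w⟩ := a
    have h₂ : ¬ s < max (t + dist x y) w := not_lt.2 ((le_planEnd y _ l).trans h)
    have h₁ : ¬ s < t + dist x y := fun h => h₂ (lt_max_of_lt_left h)
    simp only [planPos]
    rw [if_neg h₁, if_neg h₂]
    exact ih y h

/-- Stops at distance zero that need no waiting are passed at once, so the induction has to run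
through them. -/
theorem planPos_start (x : X) (t : ℝ) (l : List (Req X)) : planPos geo x t l t = x := by
  induction l generalizing x t with
  | nil => rfl
  | cons a l ih =>
    obtain ⟨y, w⟩ := a
    simp only [planPos]
    by_cases h₁ : t < t + dist x y
    · rw [if_pos h₁, sub_self, geo.path_zero]
    · have h₀ : dist x y = 0 := le_antisymm (by linarith) dist_nonneg
      rw [if_neg h₁]
      obtain rfl := eq_of_dist_eq_zero h₀
      split_ifs with h₂
      · rfl
      · have h₃ : max (t + dist x x) w = t :=
          le_antisymm (not_lt.1 h₂) (by rw [h₀, add_zero]; exact le_max_left _ _)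
        rw [h₃]
        exact ih x t

/-- Unit speed holds on the way to the first stop, during the wait there, and by induction
afterwards. The three regimes are glued at the arrival time `t + dist x y` and the departure time
`m`. -/
theorem dist_planPos_le (x : X) {t s s' : ℝ} (h₀ : t ≤ s) (h : s ≤ s') (l : List (Req X)) :
    dist (planPos geo x t l s) (planPos geo x t l s') ≤ s' - s := by
  induction l generalizing x t s with
  | nil => simp [planPos, h]
  | cons a l ih =>
    obtain ⟨y, w⟩ := a
    set m := max (t + dist x y) w with hm
    have hm₁ : t + dist x y ≤ m := le_max_left _ _
    have key : ∀ r, m ≤ r → planPos geo x t ((y, w) :: l) r = planPos geo y m l r := by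
      intro r hr
      simp only [planPos]
      rw [if_neg (by linarith), if_neg (not_lt.2 hr)]
    have wait : ∀ r, t + dist x y ≤ r → r ≤ m → planPos geo x t ((y, w) :: l) r = y := by
      intro r hr hr'
      rcases hr'.lt_or_eq with h₁ | rfl
      · simp only [planPos]
        rw [if_neg (not_lt.2 hr), if_pos h₁]
      · rw [key _ le_rfl, planPos_start]
    have move : ∀ r, t ≤ r → r ≤ t + dist x y →
        planPos geo x t ((y, w) :: l) r = geo.path x y (r - t) := by
      intro r hr hr'
      rcases hr'.lt_or_eq with h₁ | rfl
      · simp only [planPos]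
        rw [if_pos h₁]
      · rw [wait _ le_rfl hm₁, add_sub_cancel_left, geo.path_dist]
    have late : ∀ r, t ≤ r → m ≤ r → r ≤ s' →
        dist (planPos geo x t ((y, w) :: l) r) (planPos geo x t ((y, w) :: l) s') ≤ s' - r := by
      intro r _ hr' hr''
      rw [key r hr', key s' (hr'.trans hr'')]
      exact ih y hr' hr''
    have mid : ∀ r, t + dist x y ≤ r → r ≤ s' →
        dist (planPos geo x t ((y, w) :: l) r) (planPos geo x t ((y, w) :: l) s') ≤ s' - r := by
      intro r hr hr'
      have htr : t ≤ r := by linarith [dist_nonneg (x := x) (y := y)]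
      rcases le_total m r with h₁ | h₁
      · exact late r htr h₁ hr'
      rcases le_total m s' with h₂ | h₂
      · have := late m (by linarith) le_rfl h₂
        rw [wait m hm₁ le_rfl] at this
        rw [wait r hr h₁]
        linarith
      · rw [wait r hr h₁, wait s' (hr.trans hr') h₂, dist_self]
        linarith
    rcases le_total (t + dist x y) s with h₁ | h₁
    · exact mid s h₁ h
    rcases le_total (t + dist x y) s' with h₂ | h₂
    · have := mid _ le_rfl h₂
      rw [wait _ le_rfl hm₁] at this
      rw [move s h₀ h₁]
      refine (dist_triangle _ y _).trans ?_
      rw [dist_path_right geo (by linarith) (by linarith)]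
      linarith
    · rw [move s h₀ h₁, move s' (h₀.trans h) h₂,
        geo.dist_path _ _ _ _ (by linarith) (by linarith) (by linarith)]
      linarith

theorem exists_served_of_mem (x : X) (t : ℝ) {l : List (Req X)} {u : Req X} (hu : u ∈ l) :
    ∃ s, t ≤ s ∧ s ≤ planEnd x t l ∧ u.2 ≤ s ∧ planPos geo x t l s = u.1 := by
  induction l generalizing x t with
  | nil => simp at hu
  | cons a l ih =>
    obtain ⟨y, w⟩ := a
    set m := max (t + dist x y) w with hm
    have hm₁ : t + dist x y ≤ m := le_max_left _ _
    have htm : t ≤ m := by linarith [dist_nonneg (x := x) (y := y)]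
    have key : ∀ r, m ≤ r → planPos geo x t ((y, w) :: l) r = planPos geo y m l r := by
      intro r hr
      simp only [planPos]
      rw [if_neg (by linarith), if_neg (not_lt.2 hr)]
    rcases List.mem_cons.1 hu with rfl | hu
    · exact ⟨m, htm, le_planEnd y m l, le_max_right _ _, by rw [key m le_rfl, planPos_start]⟩
    · obtain ⟨s, h₁, h₂, h₃, h₄⟩ := ih y m hu
      exact ⟨s, htm.trans h₁, h₂, h₃, by rw [key s h₁, h₄]⟩

/-- A stop leaves the list only when it is completed, and at that moment the server is in its point
and its release date has passed. -/
theorem mem_planRest_or_served (x : X) {t r : ℝ} (hr : t ≤ r) {l : List (Req X)} {u : Req X}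
    (hu : u ∈ l) :
    u ∈ planRest x t l r ∨ ∃ s, t ≤ s ∧ s ≤ r ∧ u.2 ≤ s ∧ planPos geo x t l s = u.1 := by
  induction l generalizing x t with
  | nil => simp at hu
  | cons a l ih =>
    obtain ⟨y, w⟩ := a
    by_cases h₂ : r < max (t + dist x y) w
    · left
      simp only [planRest]
      rwa [if_pos h₂]
    set m := max (t + dist x y) w with hm
    have hm₁ : t + dist x y ≤ m := le_max_left _ _
    have htm : t ≤ m := by linarith [dist_nonneg (x := x) (y := y)]
    have key : ∀ r, m ≤ r → planPos geo x t ((y, w) :: l) r = planPos geo y m l r := by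
      intro r hr
      simp only [planPos]
      rw [if_neg (by linarith), if_neg (not_lt.2 hr)]
    rcases List.mem_cons.1 hu with rfl | hu
    · exact Or.inr ⟨m, htm, not_lt.1 h₂, le_max_right _ _, by rw [key m le_rfl, planPos_start]⟩
    · simp only [planRest]
      rw [if_neg h₂]
      rcases ih y (not_lt.1 h₂) hu with h | ⟨s, h₁, h₂, h₃, h₄⟩
      · exact Or.inl h
      · exact Or.inr ⟨s, htm.trans h₁, h₂, h₃, by rw [key s h₁, h₄]⟩

theorem length_planRest_le (x : X) (t s : ℝ) (l : List (Req X)) :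
    (planRest x t l s).length ≤ l.length := by
  induction l generalizing x t with
  | nil => rfl
  | cons a l ih =>
    simp only [planRest]
    split_ifs
    · exact le_rfl
    · exact (ih _ _).trans (Nat.le_succ _)

theorem splice_of_le (p : ℝ → X) {t s : ℝ} (l : List (Req X)) (h : s ≤ t) :
    splice geo p t l s = p s := if_pos h

/-- Both branches of `splice` agree at `s = t`, so case distinctions at `t` may overlap. -/
theorem splice_of_ge (p : ℝ → X) {t s : ℝ} (l : List (Req X)) (h : t ≤ s) :
    splice geo p t l s = planPos geo (p t) t l s := by
  rcases h.lt_or_eq with h | rfl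
  · exact if_neg (not_le.2 h)
  · rw [splice_of_le geo p l le_rfl, planPos_start]

theorem lipschitz_of_dist_le {p : ℝ → X} (h : ∀ s s', s ≤ s' → dist (p s) (p s') ≤ s' - s) :
    LipschitzWith 1 p := by
  refine LipschitzWith.of_dist_le_mul fun s s' => ?_
  rw [NNReal.coe_one, one_mul, Real.dist_eq]
  rcases le_total s s' with hs | hs
  · exact (h s s' hs).trans (by rw [abs_sub_comm]; exact le_abs_self _)
  · rw [dist_comm]
    exact (h s' s hs).trans (le_abs_self _)

theorem dist_le_of_lipschitz {p : ℝ → X} (h : LipschitzWith 1 p) {s s' : ℝ} (hs : s ≤ s') :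
    dist (p s) (p s') ≤ s' - s := by
  have := h.dist_le_mul s s'
  rwa [NNReal.coe_one, one_mul, Real.dist_eq, abs_sub_comm, abs_of_nonneg (by linarith)] at this

theorem lipschitz_splice {p : ℝ → X} (hp : LipschitzWith 1 p) (t : ℝ) (l : List (Req X)) :
    LipschitzWith 1 (splice geo p t l) := by
  refine lipschitz_of_dist_le fun s s' hs => ?_
  rcases le_total s' t with h₁ | h₁
  · rw [splice_of_le geo p l h₁, splice_of_le geo p l (hs.trans h₁)]
    exact dist_le_of_lipschitz hp hs
  rcases le_total t s with h₂ | h₂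
  · rw [splice_of_ge geo p l h₁, splice_of_ge geo p l h₂]
    exact dist_planPos_le geo _ h₂ hs l
  · rw [splice_of_ge geo p l h₁, splice_of_le geo p l h₂]
    have e₁ := dist_le_of_lipschitz hp h₂
    have e₂ := dist_planPos_le geo (p t) le_rfl h₁ l
    rw [planPos_start] at e₂
    linarith [dist_triangle (p s) (p t) (planPos geo (p t) t l s')]

theorem servedIn_mono {X : Type} {p : ℝ → X} {a b b' : ℝ} {q : Req X} (h : ServedIn p a b q) (hb : b ≤ b') :
    ServedIn p a b' q := by
  obtain ⟨s, h₁, h₂, h₃⟩ := h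
  exact ⟨s, h₁, h₂.trans hb, h₃⟩

theorem servedIn_congr {X : Type} {p p' : ℝ → X} {a b : ℝ} {q : Req X} (h : ∀ s, s ≤ b → p s = p' s) :
    ServedIn p a b q ↔ ServedIn p' a b q := by
  constructor
  · rintro ⟨s, h₁, h₂, h₃, h₄⟩
    exact ⟨s, h₁, h₂, h₃, by rw [← h s h₂, h₄]⟩
  · rintro ⟨s, h₁, h₂, h₃, h₄⟩
    exact ⟨s, h₁, h₂, h₃, by rw [h s h₂, h₄]⟩

/-! ### Insertion of excursions -/

theorem excursionCost_nonneg (q h : Req X) : 0 ≤ excursionCost q h := by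
  unfold excursionCost
  positivity

/-- The stop `h` is completed at a time `m ≥ h.2`. An excursion started at `m` waits no longer for
`q` than one started at `h.2`, whose duration is `excursionCost q h`. The remaining stops are
delayed by at most this amount. -/
theorem planEnd_insertExcursion_le (x : X) (t : ℝ) (h q : Req X) (l : List (Req X)) :
    planEnd x t (insertExcursion h q l) ≤ planEnd x t l + excursionCost q h := by
  induction l generalizing x t with
  | nil => exact le_add_of_nonneg_right (excursionCost_nonneg q h)
  | cons a l ih =>
    simp only [insertExcursion]
    split_ifs with ha
    · subst ha
      simp only [planEnd]
      set m := max (t + dist x a.1) a.2 with hm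
      have ham : a.2 ≤ m := le_max_right _ _
      refine (planEnd_mono a.1 ?_ l).trans (planEnd_add_le a.1 m (excursionCost_nonneg q a) l)
      unfold excursionCost
      have h₁ := le_max_left (dist a.1 q.1) (q.2 - a.2)
      have h₂ := le_max_right (dist a.1 q.1) (q.2 - a.2)
      have h₃ := dist_nonneg (x := q.1) (y := a.1)
      have h₄ := dist_nonneg (x := a.1) (y := q.1)
      refine max_le ?_ (by linarith)
      have : max (m + dist a.1 q.1) q.2 ≤ m + max (dist a.1 q.1) (q.2 - a.2) :=
        max_le (by linarith) (by linarith)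
      linarith
    · exact ih _ _

/-- As `q` is already released, only the way there and back is lost. The return stop `(x, 0)` causes
no wait because `0 ≤ t`. -/
theorem planEnd_deviation_le (x : X) {t : ℝ} (ht : 0 ≤ t) {q : Req X} (hq : q.2 ≤ t)
    (l : List (Req X)) :
    planEnd x t (q :: (x, 0) :: l) ≤ planEnd x t l + 2 * dist x q.1 := by
  have h := dist_nonneg (x := x) (y := q.1)
  refine (planEnd_mono x ?_ l).trans (planEnd_add_le x t (by positivity) l)
  simp only [dist_comm q.1 x]
  refine max_le ?_ (by linarith)
  have : max (t + dist x q.1) q.2 ≤ t + dist x q.1 := max_le le_rfl (by linarith)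
  linarith

theorem mem_insertExcursion {X : Type} {h q : Req X} {l : List (Req X)} (hl : h ∈ l) {u : Req X} :
    u ∈ insertExcursion h q l ↔ u = q ∨ u ∈ l := by
  induction l with
  | nil => simp at hl
  | cons a l ih =>
    simp only [insertExcursion]
    split_ifs with ha
    · subst ha
      simp only [List.mem_cons]
      tauto
    · rw [List.mem_cons, ih ((List.mem_cons.1 hl).resolve_left (Ne.symm ha)), List.mem_cons]
      tauto

theorem planLast_insertExcursion {X : Type} (x : X) (h q : Req X) (l : List (Req X)) :
    planLast x (insertExcursion h q l) = planLast x l := by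
  induction l generalizing x with
  | nil => rfl
  | cons a l ih =>
    simp only [insertExcursion]
    split_ifs with ha
    · subst ha; rfl
    · exact ih _

theorem length_insertExcursion_le {X : Type} (h q : Req X) (l : List (Req X)) :
    (insertExcursion h q l).length ≤ l.length + 2 := by
  induction l with
  | nil => exact Nat.zero_le _
  | cons a l ih =>
    simp only [insertExcursion]
    split_ifs with ha
    · simp
    · simpa using ih

end PlanLemmas

/-! ### Closed walks, TSP tours and lower bounds on offline costs -/

section Walks

variable {X : Type} [MetricSpace X]

theorem walkLength_nonneg (y x : X) (l : List X) : 0 ≤ walkLength y x l := by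
  induction l generalizing x with
  | nil => exact dist_nonneg
  | cons z l ih => exact add_nonneg dist_nonneg (ih z)

theorem walkLength_triangle (y x z : X) (l : List X) :
    walkLength y x l ≤ dist x z + walkLength y z l := by
  cases l with
  | nil => exact dist_triangle x z y
  | cons a l =>
    simp only [walkLength]
    linarith [dist_triangle x z a]

theorem walkLength_append (y x z : X) (l l' : List X) :
    walkLength y x (l ++ z :: l') = walkLength z x l + walkLength y z l' := by
  induction l generalizing x with
  | nil => rfl
  | cons a l ih =>
    simp only [List.cons_append, walkLength, ih]
    ring

theorem walkLength_replicate_append_le (y x z : X) (n : ℕ) (l : List X) :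
    walkLength y x (List.replicate n z ++ l) ≤ dist x z + walkLength y z l := by
  induction n generalizing x with
  | zero => exact walkLength_triangle y x z l
  | succ n ih =>
    have := ih z
    rw [dist_self, zero_add] at this
    simpa only [List.replicate_succ, List.cons_append, walkLength] using
      add_le_add_right this (dist x z)

open Classical in
/-- A walk that visits all points of `l` can be shortened to a walk that visits precisely the
points of `l`, with multiplicities. -/
theorem exists_perm_walkLength_le (y x : X) (w l : List X) (h : ∀ z ∈ l, z ∈ w) :
    ∃ l' : List X, l'.Perm l ∧ walkLength y x l' ≤ walkLength y x w := by
  induction w generalizing x l with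
  | nil =>
    have : l = [] := List.eq_nil_iff_forall_not_mem.2 fun z hz => by simpa using h z hz
    exact ⟨[], by rw [this], le_rfl⟩
  | cons a w ih =>
    obtain ⟨l', h₁, h₂⟩ := ih a (l.filter (fun z => ¬ decide (z = a) = true)) (by
      intro z hz
      rw [List.mem_filter] at hz
      exact (List.mem_cons.1 (h z hz.1)).resolve_left (by simpa using hz.2))
    -- All copies of `a` are collected at the visit of `a`; the rest of the walk only has to account
    -- for the other points.
    refine ⟨List.replicate (l.filter (fun z => decide (z = a))).length a ++ l', ?_, ?_⟩
    · have : List.replicate (l.filter (fun z => decide (z = a))).length a =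
          l.filter (fun z => decide (z = a)) :=
        (List.eq_replicate_of_mem fun b hb => by simpa using (List.mem_filter.1 hb).2).symm
      rw [this]
      refine (h₁.append_left _).trans ?_
      simpa using List.filter_append_perm (fun z => decide (z = a)) l
    · refine (walkLength_replicate_append_le y x a _ l').trans ?_
      simp only [walkLength]
      linarith

/-- The length of a shortest closed walk from `x` that visits all points of `P`. -/
def coverWalk (P : Set X) (x : X) : ℝ≥0∞ :=
  ⨅ w : {w : List X // ∀ z ∈ P, z ∈ w}, ENNReal.ofReal (walkLength x x w)

theorem coverWalk_le {P : Set X} {x : X} {w : List X} (h : ∀ z ∈ P, z ∈ w) :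
    coverWalk P x ≤ ENNReal.ofReal (walkLength x x w) :=
  iInf_le (fun w : {w : List X // ∀ z ∈ P, z ∈ w} => ENNReal.ofReal (walkLength x x w)) ⟨w, h⟩

theorem coverWalk_mono {P Q : Set X} (h : P ⊆ Q) (x : X) : coverWalk P x ≤ coverWalk Q x :=
  le_iInf fun w => coverWalk_le fun z hz => w.2 z (h hz)

/-- Insertion of a closed walk into a closed walk. -/
theorem coverWalk_union_le {P Q : Set X} {x b : X} (hb : b ∈ P ∨ b = x) :
    coverWalk (P ∪ Q) x ≤ coverWalk P x + coverWalk Q b := by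
  refine ENNReal.le_iInf_add_iInf ?_
  rintro ⟨w, hw⟩ ⟨v, hv⟩
  rw [← ENNReal.ofReal_add (walkLength_nonneg _ _ _) (walkLength_nonneg _ _ _)]
  -- If `w` passes through `b`, the closed walk `v` is spliced in there; otherwise `b` is the start
  -- `x`, and `v` is traversed after `w`.
  by_cases hbw : b ∈ w
  · obtain ⟨w₁, w₂, rfl⟩ := List.append_of_mem hbw
    refine (coverWalk_le (w := w₁ ++ b :: (v ++ b :: w₂)) ?_).trans
      (ENNReal.ofReal_le_ofReal ?_)
    · rintro z (hz | hz)
      · have := hw z hz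
        simp only [List.mem_append, List.mem_cons] at this ⊢
        tauto
      · have := hv z hz
        simp only [List.mem_append, List.mem_cons]
        tauto
    · rw [walkLength_append, walkLength_append, walkLength_append]
      linarith
  · obtain rfl : b = x := hb.resolve_left fun h => hbw (hw b h)
    refine (coverWalk_le (w := w ++ b :: v) ?_).trans (ENNReal.ofReal_le_ofReal ?_)
    · rintro z (hz | hz)
      · exact List.mem_append_left _ (hw z hz)
      · exact List.mem_append_right _ (List.mem_cons_of_mem _ (hv z hz))
    · rw [walkLength_append]

/-- The guarantee of `tsp` compares only with orderings of `l`; by shortcutting, it extends to all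
closed walks that visit the points of `l`. -/
theorem walkLength_tsp_le {ν : ℝ≥0} {tsp : X × List X → List X} (htsp : IsTSPApprox ν tsp) (o : X)
    (l : List X) :
    ENNReal.ofReal (walkLength o o (tsp (o, l))) ≤ ν * coverWalk {z | z ∈ l} o := by
  unfold coverWalk
  have : Nonempty {w : List X // ∀ z ∈ {z | z ∈ l}, z ∈ w} := ⟨⟨l, fun z hz => hz⟩⟩
  rw [ENNReal.mul_iInf (fun h => absurd h ENNReal.coe_ne_top)]
  refine le_iInf ?_
  rintro ⟨w, hw⟩
  obtain ⟨l', h₁, h₂⟩ := exists_perm_walkLength_le o o w l hw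
  rw [← ENNReal.ofReal_coe_nnreal, ← ENNReal.ofReal_mul ν.coe_nonneg]
  exact ENNReal.ofReal_le_ofReal
    (((htsp o l).2 l' h₁).trans (mul_le_mul_of_nonneg_left h₂ ν.2))

theorem walkLength_map_le {p : ℝ → X} (hp : LipschitzWith 1 p) {a b : ℝ} (hab : a ≤ b)
    {ts : List ℝ} (h : ts.Pairwise (· ≤ ·)) (hts : ∀ s ∈ ts, a ≤ s ∧ s ≤ b) :
    walkLength (p b) (p a) (ts.map p) ≤ b - a := by
  induction ts generalizing a with
  | nil => exact dist_le_of_lipschitz hp hab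
  | cons s ts ih =>
    rw [List.pairwise_cons] at h
    have hs := hts s (List.mem_cons_self ..)
    have h₁ := ih hs.2 h.2 fun r hr => ⟨h.1 r hr, (hts r (List.mem_cons_of_mem _ hr)).2⟩
    have h₂ := dist_le_of_lipschitz hp hs.1
    simp only [List.map_cons, walkLength]
    linarith

/-- Sampling a feasible trajectory at one service time per request, in increasing order, gives a
closed walk that is no longer than the duration, by unit speed. -/
theorem coverWalk_le_optMakespan (S : Finset (Req X)) (b : Req X) :
    coverWalk (Prod.fst '' (S : Set (Req X))) b.1 ≤ optMakespan S b := by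
  classical
  refine le_iInf ?_
  rintro ⟨T, p, hp, h₀, h₁, hS⟩
  change _ ≤ (T : ℝ≥0∞)
  have hT : b.2 ≤ b.2 + (T : ℝ) := le_add_of_nonneg_right T.2
  choose! s hs₁ hs₂ hs₃ hs₄ using hS
  let ts := (S.image s).sort (· ≤ ·)
  have hmem : ∀ r, r ∈ ts ↔ r ∈ S.image s := fun r => Finset.mem_sort _
  have hlen := walkLength_map_le hp hT (ts := ts) (Finset.pairwise_sort _ _) (by
    intro r hr
    obtain ⟨q, hq, rfl⟩ := Finset.mem_image.1 ((hmem r).1 hr)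
    exact ⟨hs₁ q hq, hs₂ q hq⟩)
  rw [h₀, h₁, add_sub_cancel_left] at hlen
  refine (coverWalk_le (w := ts.map p) ?_).trans
    ((ENNReal.ofReal_le_ofReal hlen).trans (by rw [ENNReal.ofReal_coe_nnreal]))
  rintro z ⟨q, hq, rfl⟩
  exact List.mem_map.2 ⟨s q, (hmem _).2 (Finset.mem_image_of_mem s hq), hs₄ q hq⟩

theorem release_le_optMakespan {S : Finset (Req X)} {q : Req X} (hq : q ∈ S) (b : Req X) :
    ENNReal.ofReal q.2 ≤ ENNReal.ofReal b.2 + optMakespan S b := by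
  refine tsub_le_iff_left.1 (le_iInf ?_)
  rintro ⟨T, p, -, -, -, hS⟩
  obtain ⟨s, -, hs, hs', -⟩ := hS q hq
  refine tsub_le_iff_left.2 ?_
  calc ENNReal.ofReal q.2 ≤ ENNReal.ofReal (b.2 + T) := ENNReal.ofReal_le_ofReal (by linarith)
    _ ≤ _ := ENNReal.ofReal_add_le.trans (by rw [ENNReal.ofReal_coe_nnreal])

/-! ### Covers -/

-- Start with an optimal tour for `B` and attach the closed tour of each hyperedge `(A', b)` at the
-- point of `b`, which the walk visits already. The size bound `k` plays no role.
open Classical in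
theorem coverWalk_union_le_coverCost {k : ℕ∞} (A B : Finset (Req X)) (o : X) :
    coverWalk (Prod.fst '' (B : Set (Req X)) ∪ Prod.fst '' (A : Set (Req X))) o ≤
      optMakespan B (o, 0) + coverCost k A B := by
  unfold coverCost
  rw [ENNReal.add_iInf]
  refine le_iInf ?_
  rintro ⟨H, hH⟩
  -- Hyperedges are added one at a time; the points of `B` stay in the covered set, so a point of
  -- attachment is always available.
  have key : ∀ H' ⊆ H, coverWalk (Prod.fst '' (B : Set (Req X)) ∪
      {z | ∃ e ∈ H', z ∈ Prod.fst '' (e.1 : Set (Req X))}) o ≤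
      optMakespan B (o, 0) + ∑ e ∈ H', optMakespan e.1 e.2 := by
    intro H'
    induction H' using Finset.induction_on with
    | empty =>
      intro _
      simpa using coverWalk_le_optMakespan B (o, 0)
    | insert e H' he ih =>
      intro hsub
      rw [Finset.sum_insert he, add_left_comm, add_comm]
      have hb : e.2 ∈ B := (hH.1 e (hsub (Finset.mem_insert_self e H'))).2.2
      refine le_trans ?_ (add_le_add (ih fun f hf => hsub (Finset.mem_insert_of_mem hf))
        (coverWalk_le_optMakespan e.1 e.2))
      refine (coverWalk_mono ?_ o).trans (coverWalk_union_le (Or.inl (Or.inl ⟨e.2, hb, rfl⟩)))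
      rintro z (hz | ⟨f, hf, hz⟩)
      · exact Or.inl (Or.inl hz)
      · rcases Finset.mem_insert.1 hf with rfl | hf
        · exact Or.inr hz
        · exact Or.inl (Or.inr ⟨f, hf, hz⟩)
  refine (coverWalk_mono ?_ o).trans (key H subset_rfl)
  rintro z (hz | ⟨a, ha, rfl⟩)
  · exact Or.inl hz
  · obtain ⟨e, he, hae⟩ := hH.2 a ha
    exact Or.inr ⟨e, he, a, hae, rfl⟩

/-- The hyperedge that covers `a`, started at `b.2 ≤ C`, cannot be completed before `a` is released.
-/
theorem release_le_coverCost {k : ℕ∞} {A B : Finset (Req X)} {C : ℝ≥0∞}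
    (hB : ∀ b ∈ B, ENNReal.ofReal b.2 ≤ C) {a : Req X} (ha : a ∈ A) :
    ENNReal.ofReal a.2 ≤ C + coverCost k A B := by
  unfold coverCost
  rw [ENNReal.add_iInf]
  refine le_iInf ?_
  rintro ⟨H, hH⟩
  obtain ⟨e, he, hae⟩ := hH.2 a ha
  exact (release_le_optMakespan hae e.2).trans (add_le_add (hB _ (hH.1 e he).2.2)
    (Finset.single_le_sum (f := fun e => optMakespan e.1 e.2) (fun _ _ => zero_le) he))

open Classical in
/-- A cover by hyperedges with at most one covered request is at least as expensive as it is to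
cover each request individually at minimum cost. -/
theorem sum_le_coverCost_one (geo : ShortestPaths X) {A B : Finset (Req X)} {m : Req X → ℝ}
    (hm : ∀ a ∈ A, ∀ b ∈ B, m a ≤ excursionCost a b) :
    ∑ a ∈ A, ENNReal.ofReal (m a) ≤ coverCost 1 A B := by
  refine le_iInf ?_
  rintro ⟨H, hH⟩
  -- A hyperedge that contains `a` and covers at most one request is `{a}`. So different requests
  -- use different hyperedges, and their costs add up.
  have hex : ∀ a ∈ A, ∃ e ∈ H, e.1 = {a} := by
    intro a ha
    obtain ⟨e, he, hae⟩ := hH.2 a ha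
    have hc : e.1.card ≤ 1 := by exact_mod_cast (hH.1 e he).2.1
    refine ⟨e, he, Finset.eq_singleton_iff_unique_mem.2 ⟨hae, fun x hx => ?_⟩⟩
    exact Finset.card_le_one.1 hc x hx a hae
  choose! f hf hf' using hex
  have hinj : Set.InjOn f (A : Set (Req X)) := by
    intro a ha a' ha' h
    have := hf' a ha
    rw [h, hf' a' ha'] at this
    exact (Finset.singleton_injective this).symm
  calc ∑ a ∈ A, ENNReal.ofReal (m a)
      ≤ ∑ a ∈ A, optMakespan (f a).1 (f a).2 := by
        refine Finset.sum_le_sum fun a ha => ?_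
        rw [hf' a ha, optMakespan_singleton geo]
        exact ENNReal.ofReal_le_ofReal (hm a ha _ (hH.1 _ (hf a ha)).2.2)
    _ = ∑ e ∈ A.image f, optMakespan e.1 e.2 := by
        rw [Finset.sum_image hinj]
    _ ≤ ∑ e ∈ H, optMakespan e.1 e.2 :=
        Finset.sum_le_sum_of_subset (Finset.image_subset_iff.2 hf)

end Walks

/-! ### Duration of tours through sets of requests -/

section Tours

variable {X : Type} [MetricSpace X]

/-- The comparison is with a server that does all its waiting at the start: from time `M` on, no
stop forces it to wait. -/
theorem planEnd_le_walkLength (o x : X) {t M : ℝ} (hM : 0 ≤ M) (l : List (Req X))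
    (hl : ∀ u ∈ l, u.2 ≤ M) :
    planEnd x t (l ++ [(o, 0)]) ≤ max t M + walkLength o x (l.map Prod.fst) := by
  induction l generalizing x t with
  | nil =>
    have h₁ := le_max_left t M
    have h₂ := le_max_right t M
    have h₃ := dist_nonneg (x := x) (y := o)
    exact max_le (by simp only [List.map_nil, walkLength]; linarith)
      (by simp only [List.map_nil, walkLength]; linarith)
  | cons a l ih =>
    refine (ih a.1 fun u hu => hl u (List.mem_cons_of_mem _ hu)).trans ?_
    have h₀ := hl a (List.mem_cons_self ..)
    have h₁ := le_max_left t M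
    have h₂ := le_max_right t M
    have h₃ := dist_nonneg (x := x) (y := a.1)
    simp only [List.map_cons, walkLength]
    have : max (max (t + dist x a.1) a.2) M ≤ max t M + dist x a.1 :=
      max_le (max_le (by linarith) (by linarith)) (by linarith)
    linarith

theorem walkLength_le_planEnd (o x : X) (t : ℝ) (l : List (Req X)) :
    t + walkLength o x (l.map Prod.fst) ≤ planEnd x t (l ++ [(o, 0)]) := by
  induction l generalizing x t with
  | nil => exact le_max_left _ _
  | cons a l ih =>
    have h₀ := ih a.1 (max (t + dist x a.1) a.2)
    have h₁ := le_max_left (t + dist x a.1) a.2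
    simp only [List.map_cons, walkLength, List.cons_append, planEnd]
    linarith

theorem release_le_planEnd (x : X) (t : ℝ) {l : List (Req X)} {u : Req X} (hu : u ∈ l) :
    u.2 ≤ planEnd x t l := by
  induction l generalizing x t with
  | nil => simp at hu
  | cons a l ih =>
    rcases List.mem_cons.1 hu with rfl | hu
    · exact (le_max_right _ _).trans (le_planEnd _ _ _)
    · exact ih _ _ hu

open Classical in
/-- The stops of a tour before the return to the origin. -/
def tourStops (o : X) (tsp : X × List X → List X) (U : List (Req X)) : List (Req X) :=
  (tsp (o, U.map Prod.fst)).flatMap (fun x => U.filter (fun q => q.1 = x))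

theorem tour_eq {X : Type} (o : X) (tsp : X × List X → List X) (U : List (Req X)) :
    tour o tsp U = tourStops o tsp U ++ [(o, 0)] := rfl

variable {ν : ℝ≥0} {tsp : X × List X → List X} (o : X)

theorem mem_tourStops (htsp : IsTSPApprox ν tsp) (U : List (Req X)) (u : Req X) : u ∈ tourStops o tsp U ↔ u ∈ U := by
  simp only [tourStops, List.mem_flatMap, List.mem_filter, decide_eq_true_eq]
  constructor
  · rintro ⟨x, -, h, -⟩
    exact h
  · intro h
    exact ⟨u.1, ((htsp o _).1.mem_iff).2 (List.mem_map_of_mem h), h, rfl⟩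

-- All stops generated by one entry `z` lie in `z`, so passing through them costs no distance,
-- however often they are repeated.
open Classical in
theorem walkLength_flatMap_filter_le (y x : X) (l : List X) (U : List (Req X)) :
    walkLength y x ((l.flatMap (fun z => U.filter (fun q => q.1 = z))).map Prod.fst) ≤
      walkLength y x l := by
  induction l generalizing x with
  | nil => exact le_rfl
  | cons a l ih =>
    rw [List.flatMap_cons, List.map_append]
    have : (U.filter (fun q => q.1 = a)).map Prod.fst =
        List.replicate ((U.filter (fun q => q.1 = a)).map Prod.fst).length a :=
      List.eq_replicate_of_mem fun b hb => by
        obtain ⟨q, hq, rfl⟩ := List.mem_map.1 hb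
        simpa using (List.mem_filter.1 hq).2
    rw [this]
    refine (walkLength_replicate_append_le y x a _ _).trans ?_
    simp only [walkLength]
    linarith [ih a]

/-- A tour is completed once all its requests have been released and a TSP tour through its points
has been traversed after that. -/
theorem planEnd_tour_le (x : X) {t M : ℝ} (hM : 0 ≤ M) (U : List (Req X))
    (hU : ∀ u ∈ U, u.2 ≤ M) (htsp : IsTSPApprox ν tsp) {L : ℝ}
    (hL : coverWalk {z | z ∈ U.map Prod.fst} o ≤ ENNReal.ofReal L) (hL₀ : 0 ≤ L) :
    planEnd x t (tour o tsp U) ≤ max (t + dist x o) M + ν * L := by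
  -- Going to `o` first can only delay the end, and turns the rest into a closed walk, to which the
  -- guarantee of `tsp` applies.
  refine (planEnd_triangle x o t _).trans ?_
  rw [tour_eq]
  refine (planEnd_le_walkLength o o hM _ fun u hu => hU u ((mem_tourStops o htsp U u).1 hu)).trans ?_
  gcongr
  refine (walkLength_flatMap_filter_le o o _ U).trans ?_
  have := (walkLength_tsp_le htsp o (U.map Prod.fst)).trans (mul_le_mul_right hL _)
  rw [← ENNReal.ofReal_coe_nnreal, ← ENNReal.ofReal_mul ν.coe_nonneg] at this
  exact (ENNReal.ofReal_le_ofReal_iff (mul_nonneg ν.2 hL₀)).1 this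

theorem coverWalk_le_tourLength (htsp : IsTSPApprox ν tsp) (U : List (Req X)) :
    coverWalk {z | z ∈ U.map Prod.fst} o ≤ ENNReal.ofReal (tourLength o tsp U) := by
  refine (coverWalk_le (w := (tourStops o tsp U).map Prod.fst) ?_).trans
    (ENNReal.ofReal_le_ofReal ?_)
  · intro z hz
    obtain ⟨u, hu, rfl⟩ := List.mem_map.1 hz
    exact List.mem_map_of_mem ((mem_tourStops o htsp U u).2 hu)
  · have := walkLength_le_planEnd o o 0 (tourStops o tsp U)
    rwa [zero_add] at this

theorem release_le_tourLength (htsp : IsTSPApprox ν tsp) {U : List (Req X)} {u : Req X}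
    (hu : u ∈ U) : u.2 ≤ tourLength o tsp U :=
  release_le_planEnd o 0 (List.mem_append_left _ ((mem_tourStops o htsp U u).2 hu))

theorem tourLength_nonneg (tsp : X × List X → List X) (U : List (Req X)) :
    0 ≤ tourLength o tsp U := le_planEnd _ _ _

theorem planLast_tour {X : Type} (o x : X) (tsp : X × List X → List X) (U : List (Req X)) :
    planLast x (tour o tsp U) = o := by
  rw [tour_eq, planLast_append]
  rfl

end Tours

/-! ### Trajectories: unit speed, dependence on the past, and the three phases -/

section Trajectories

variable {X : Type} [MetricSpace X] (geo : ShortestPaths X)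

theorem splice_congr {p p' : ℝ → X} {t : ℝ} (h : ∀ s ≤ t, p s = p' s) (l : List (Req X)) :
    splice geo p t l = splice geo p' t l := by
  funext s
  unfold splice
  split_ifs with hs
  · exact h s hs
  · rw [h t le_rfl]

/-! ### Online algorithms without predictions -/

section Online

variable (A : List (Req X) → List (Req X))

theorem onlineRun_of_le (p : ℝ → X) {t s : ℝ} (pre R : List (Req X)) (hs : s ≤ t)
    (hR : R.Pairwise (fun q q' => q.2 ≤ q'.2)) (ht : ∀ q ∈ R, t ≤ q.2) :
    onlineRun geo A p t pre R s = p s := by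
  induction R generalizing p t pre with
  | nil => exact splice_of_le geo p _ hs
  | cons q R ih =>
    rw [List.pairwise_cons] at hR
    refine (ih _ _ (hs.trans (ht q (List.mem_cons_self ..))) hR.2 hR.1).trans ?_
    exact splice_of_le geo p _ hs

/-- Decisions at releases after `s` leave the trajectory up to `s` unchanged. -/
theorem onlineRun_append (p : ℝ → X) {t s : ℝ} (pre R R' : List (Req X))
    (hR : (R ++ R').Pairwise (fun q q' => q.2 ≤ q'.2)) (hs : ∀ q ∈ R', s < q.2) :
    onlineRun geo A p t pre (R ++ R') s = onlineRun geo A p t pre R s := by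
  induction R generalizing p t pre with
  | nil =>
    cases R' with
    | nil => rfl
    | cons q R' =>
      rw [List.nil_append, List.pairwise_cons] at hR
      exact onlineRun_of_le geo A _ _ _ (hs q (List.mem_cons_self ..)).le hR.2 hR.1
  | cons q R ih => exact ih _ _ (List.pairwise_cons.1 hR).2

theorem lipschitz_onlineRun {p : ℝ → X} (hp : LipschitzWith 1 p) (t : ℝ) (pre R : List (Req X)) :
    LipschitzWith 1 (onlineRun geo A p t pre R) := by
  induction R generalizing p t pre with
  | nil => exact lipschitz_splice geo hp _ _
  | cons q R ih => exact ih (lipschitz_splice geo hp _ _) _ _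

theorem lipschitz_onlinePos (o : X) (R : List (Req X)) : LipschitzWith 1 (onlinePos geo o A R) :=
  lipschitz_onlineRun geo A (LipschitzWith.const' o) 0 [] R

theorem onlinePos_zero (o : X) {R : List (Req X)} (hR : IsInstance R) :
    onlinePos geo o A R 0 = o :=
  onlineRun_of_le geo A _ [] R le_rfl hR.2 hR.1.2

end Online

/-! ### The end of phase (i), and phase (ii) -/

section Home

variable {o : X} {p : ℝ → X} {B : ℝ}

/-- The supremum is attained because the set is closed, contains 0 and is bounded by `B`. This is
what lets the server reach `o` in time. -/
theorem phaseOneEnd_mem (hp : LipschitzWith 1 p) (h₀ : p 0 = o) (hB : 0 ≤ B) :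
    0 ≤ phaseOneEnd o p B ∧ phaseOneEnd o p B ≤ B - dist (p (phaseOneEnd o p B)) o := by
  have hcl : IsClosed {t : ℝ | 0 ≤ t ∧ t ≤ B - dist (p t) o} :=
    (isClosed_le continuous_const continuous_id).inter (isClosed_le continuous_id
      (continuous_const.sub (hp.continuous.dist continuous_const)))
  exact hcl.csSup_mem ⟨0, le_rfl, by rw [h₀, dist_self, sub_zero]; exact hB⟩
    ⟨B, fun _ ht => ht.2.trans (sub_le_self _ dist_nonneg)⟩

theorem le_phaseOneEnd {t : ℝ} (ht : 0 ≤ t) (h : t ≤ B - dist (p t) o) :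
    t ≤ phaseOneEnd o p B :=
  le_csSup ⟨B, fun _ hs => hs.2.trans (sub_le_self _ dist_nonneg)⟩ ⟨ht, h⟩

/-- A server that can still get home in time at `t` could do so at any earlier time, via `p t`.
Hence phase (i) is an interval. -/
theorem le_phaseOneEnd_of_le (hp : LipschitzWith 1 p) {s t : ℝ} (hst : s ≤ t)
    (h : t ≤ B - dist (p t) o) : s ≤ B - dist (p s) o := by
  linarith [dist_le_of_lipschitz hp hst, dist_triangle (p s) (p t) o]

/-- Trajectories that agree up to `t` may end phase (i) at different times, but only if neither has
ended it before `t`. -/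
theorem phaseOneEnd_congr {p' : ℝ → X} (hp : LipschitzWith 1 p) (hp' : LipschitzWith 1 p')
    (h₀ : p 0 = o) (h₀' : p' 0 = o) (hB : 0 ≤ B) {t : ℝ} (h : ∀ s ≤ t, p s = p' s) :
    phaseOneEnd o p B = phaseOneEnd o p' B ∨
      t ≤ phaseOneEnd o p B ∧ t ≤ phaseOneEnd o p' B := by
  have key : ∀ {p p' : ℝ → X}, LipschitzWith 1 p → LipschitzWith 1 p' → p 0 = o → p' 0 = o →
      (∀ s ≤ t, p s = p' s) → phaseOneEnd o p B < t →
      phaseOneEnd o p B = phaseOneEnd o p' B := by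
    intro p p' hp hp' h₀ h₀' h hlt
    obtain ⟨h₁, h₂⟩ := phaseOneEnd_mem hp h₀ hB
    obtain ⟨h₁', h₂'⟩ := phaseOneEnd_mem hp' h₀' hB
    apply le_antisymm
    · exact le_phaseOneEnd h₁ (by rw [← h _ hlt.le]; exact h₂)
    -- If `p'` stayed in phase (i) longer, the minimum of `t` and its end would be an admissible
    -- time for `p'`, hence for `p`, beyond the end for `p`.
    · by_contra hcon
      have hlt' := lt_min hlt (not_le.1 hcon)
      refine absurd (le_phaseOneEnd (h₁.trans hlt'.le) ?_) (not_le.2 hlt')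
      rw [h _ (min_le_left _ _)]
      exact le_phaseOneEnd_of_le hp' (min_le_right _ _) h₂'
  by_cases h₁ : phaseOneEnd o p B < t
  · exact Or.inl (key hp hp' h₀ h₀' h h₁)
  by_cases h₂ : phaseOneEnd o p' B < t
  · exact Or.inl (key hp' hp h₀' h₀ (fun s hs => (h s hs).symm) h₂).symm
  exact Or.inr ⟨not_lt.1 h₁, not_lt.1 h₂⟩

/-- The trajectory of a server that follows `p` in phase (i) and moves home in phase (ii). -/
def homePos (o : X) (p : ℝ → X) (B : ℝ) : ℝ → X :=
  splice geo p (phaseOneEnd o p B) [(o, 0)]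

theorem homePos_congr {p' : ℝ → X} (hp : LipschitzWith 1 p) (hp' : LipschitzWith 1 p')
    (h₀ : p 0 = o) (h₀' : p' 0 = o) (hB : 0 ≤ B) {t : ℝ} (h : ∀ s ≤ t, p s = p' s) :
    ∀ s ≤ t, homePos geo o p B s = homePos geo o p' B s := by
  intro s hs
  unfold homePos
  rcases phaseOneEnd_congr hp hp' h₀ h₀' hB h with h₁ | ⟨h₁, h₂⟩
  · rw [← h₁]
    rcases le_total s (phaseOneEnd o p B) with h₂ | h₂
    · rw [splice_of_le geo _ _ h₂, splice_of_le geo _ _ h₂, h s hs]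
    · rw [splice_of_ge geo _ _ h₂, splice_of_ge geo _ _ h₂, h _ (h₂.trans hs)]
  · rw [splice_of_le geo _ _ (hs.trans h₁), splice_of_le geo _ _ (hs.trans h₂), h s hs]

theorem homePos_budget (hp : LipschitzWith 1 p) (h₀ : p 0 = o) (hB : 0 ≤ B) :
    homePos geo o p B B = o := by
  obtain ⟨h₁, h₂⟩ := phaseOneEnd_mem hp h₀ hB
  have h₃ := dist_nonneg (x := p (phaseOneEnd o p B)) (y := o)
  unfold homePos
  rw [splice_of_ge geo _ _ (by linarith), planPos_of_planEnd_le]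
  · rfl
  · exact max_le (by linarith) hB

end Home

/-! ### Phase (iii) -/

section Replanning

variable (o : X) (tsp : X × List X → List X) (pred : List (Req X))

open Classical in
/-- The situation in which the request `q` is inserted. -/
def situationAt (p : ℝ → X) (t : ℝ) (l seen : List (Req X)) (q : Req X) : Situation X where
  pred := pred
  unserved := (pred ++ seen).filter
    (fun u => ¬ ServedIn (splice geo p t l) 0 (max t q.2) u) ++ [q]
  rest := planRest (p t) t l (max t q.2)
  now := max t q.2
  pos := splice geo p t l (max t q.2)
  new := q

theorem predictReplan_cons (p : ℝ → X) (t : ℝ) (l seen : List (Req X)) (q : Req X)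
    (R : List (Req X)) :
    predictReplan geo o tsp pred p t l seen (q :: R) =
      ((predictReplan geo o tsp pred (splice geo p t l) (max t q.2)
        (replan o tsp (situationAt geo pred p t l seen q)) (seen ++ [q]) R).1,
      situationAt geo pred p t l seen q ::
        (predictReplan geo o tsp pred (splice geo p t l) (max t q.2)
          (replan o tsp (situationAt geo pred p t l seen q)) (seen ++ [q]) R).2) := rfl

theorem predictReplan_of_le (p : ℝ → X) {t s : ℝ} (l seen R : List (Req X)) (hs : s ≤ t) :
    (predictReplan geo o tsp pred p t l seen R).1 s = p s := by
  induction R generalizing p t l seen with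
  | nil => exact splice_of_le geo p l hs
  | cons q R ih =>
    rw [predictReplan_cons]
    exact (ih _ _ _ (le_max_of_le_left hs)).trans (splice_of_le geo p l hs)

/-- A request is never inserted before its release, so those in `R'` cannot influence the trajectory
up to `s`. -/
theorem predictReplan_append (p : ℝ → X) {t s : ℝ} (l seen R R' : List (Req X))
    (hs : ∀ q ∈ R', s < q.2) :
    (predictReplan geo o tsp pred p t l seen (R ++ R')).1 s =
      (predictReplan geo o tsp pred p t l seen R).1 s := by
  induction R generalizing p t l seen with
  | nil =>
    cases R' with
    | nil => rfl
    | cons q R' =>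
      exact predictReplan_of_le geo o tsp pred _ _ _ _
        (le_max_of_le_right (hs q (List.mem_cons_self ..)).le)
  | cons q R ih =>
    rw [List.cons_append, predictReplan_cons, predictReplan_cons]
    exact ih _ _ _

theorem situationAt_congr {p p' : ℝ → X} {t : ℝ} (h : ∀ s ≤ t, p s = p' s)
    (l seen : List (Req X)) (q : Req X) :
    situationAt geo pred p t l seen q = situationAt geo pred p' t l seen q := by
  unfold situationAt
  rw [splice_congr geo h, h t le_rfl]

theorem predictReplan_congr {p p' : ℝ → X} {t : ℝ} (h : ∀ s ≤ t, p s = p' s)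
    (l seen R : List (Req X)) :
    predictReplan geo o tsp pred p t l seen R = predictReplan geo o tsp pred p' t l seen R := by
  cases R with
  | nil => simp only [predictReplan, splice_congr geo h]
  | cons q R =>
    rw [predictReplan_cons, predictReplan_cons, situationAt_congr geo pred h, splice_congr geo h]

theorem lipschitz_predictReplan {p : ℝ → X} (hp : LipschitzWith 1 p) (t : ℝ)
    (l seen R : List (Req X)) :
    LipschitzWith 1 (predictReplan geo o tsp pred p t l seen R).1 := by
  induction R generalizing p t l seen with
  | nil => exact lipschitz_splice geo hp _ _
  | cons q R ih => exact ih (lipschitz_splice geo hp _ _) _ _ _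

open Classical in
/-- The tour `T₁`. -/
def extendedTour (h : Req X) (c : Situation X) : List (Req X) :=
  if h ∈ c.rest then insertExcursion h c.new c.rest else c.new :: (c.pos, 0) :: c.rest

open Classical in
theorem replan_of_argmin {c : Situation X} {h : Req X}
    (hh : c.pred.argmin (excursionCost c.new) = some h) :
    replan o tsp c =
      if planEnd c.pos c.now (extendedTour h c) ≤ planEnd c.pos c.now (tour o tsp c.unserved)
        then extendedTour h c else tour o tsp c.unserved := by
  unfold replan
  rw [hh]
  rfl

theorem replan_of_argmin_eq_none {c : Situation X}
    (hh : c.pred.argmin (excursionCost c.new) = none) : replan o tsp c = tour o tsp c.unserved := by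
  unfold replan
  rw [hh]

theorem replan_eq (c : Situation X) : replan o tsp c = tour o tsp c.unserved ∨
    ∃ h, replan o tsp c = extendedTour h c := by
  cases hh : c.pred.argmin (excursionCost c.new) with
  | none => exact Or.inl (replan_of_argmin_eq_none o tsp hh)
  | some h =>
    rw [replan_of_argmin o tsp hh]
    split_ifs
    · exact Or.inr ⟨h, rfl⟩
    · exact Or.inl rfl

theorem planEnd_replan_le_tour (c : Situation X) :
    planEnd c.pos c.now (replan o tsp c) ≤ planEnd c.pos c.now (tour o tsp c.unserved) := by
  cases hh : c.pred.argmin (excursionCost c.new) with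
  | none => rw [replan_of_argmin_eq_none o tsp hh]
  | some h =>
    rw [replan_of_argmin o tsp hh]
    split_ifs with hle
    · exact hle
    · exact le_rfl

theorem planEnd_replan_le_extendedTour {c : Situation X} {h : Req X}
    (hh : c.pred.argmin (excursionCost c.new) = some h) :
    planEnd c.pos c.now (replan o tsp c) ≤ planEnd c.pos c.now (extendedTour h c) := by
  rw [replan_of_argmin o tsp hh]
  split_ifs with hle
  · exact le_rfl
  · exact (not_le.1 hle).le

theorem planLast_extendedTour {X : Type} (h : Req X) (c : Situation X) :
    planLast c.pos (extendedTour h c) = planLast c.pos c.rest := by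
  unfold extendedTour
  split_ifs
  · exact planLast_insertExcursion ..
  · rfl

theorem mem_extendedTour {X : Type} {h : Req X} {c : Situation X} {u : Req X}
    (hu : u = c.new ∨ u ∈ c.rest) : u ∈ extendedTour h c := by
  unfold extendedTour
  split_ifs with hh
  · exact (mem_insertExcursion hh).2 hu
  · simp only [List.mem_cons]
    tauto

/-- At time `t`, having moved along `p`, the server is going to serve all requests that are
predicted or have been seen and not yet been served, and to return to the origin. Phase (iii) has
started in the origin at time `B`. -/
structure PlanInv (B : ℝ) (seen : List (Req X)) (p : ℝ → X) (t : ℝ) (l : List (Req X)) :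
    Prop where
  lipschitz : LipschitzWith 1 p
  budget_nonneg : 0 ≤ B
  budget_le : B ≤ t
  home : p B = o
  covered : ∀ u ∈ pred ++ seen, ServedIn p 0 t u ∨ u ∈ l
  last : planLast (p t) l = o

variable {o tsp pred} {B : ℝ} {seen : List (Req X)} {p : ℝ → X} {t : ℝ} {l : List (Req X)}

theorem PlanInv.covered_rest (H : PlanInv o pred B seen p t l) {r : ℝ} (hr : t ≤ r) :
    ∀ u ∈ pred ++ seen, ServedIn (splice geo p t l) 0 r u ∨ u ∈ planRest (p t) t l r := by
  intro u hu
  rcases H.covered u hu with h | h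
  · exact Or.inl (servedIn_mono ((servedIn_congr fun s hs => splice_of_le geo p l hs).2 h) hr)
  · rcases mem_planRest_or_served geo (p t) hr h with h | ⟨s, h₁, h₂, h₃, h₄⟩
    · exact Or.inr h
    · exact Or.inl ⟨s, (H.budget_nonneg.trans H.budget_le).trans h₁, h₂, h₃,
        by rw [splice_of_ge geo p l h₁, h₄]⟩

theorem PlanInv.step (htour : ∀ U, ∀ u ∈ U, u ∈ tour o tsp U)
    (H : PlanInv o pred B seen p t l) (q : Req X) :
    PlanInv o pred B (seen ++ [q]) (splice geo p t l) (max t q.2)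
      (replan o tsp (situationAt geo pred p t l seen q)) where
  lipschitz := lipschitz_splice geo H.lipschitz _ _
  budget_nonneg := H.budget_nonneg
  budget_le := le_max_of_le_left H.budget_le
  home := by rw [splice_of_le geo p l H.budget_le, H.home]
  covered := by
    intro u hu
    rw [← List.append_assoc, List.mem_append, List.mem_singleton] at hu
    rcases replan_eq o tsp (situationAt geo pred p t l seen q) with h | ⟨h', h⟩
    · by_cases hs : ServedIn (splice geo p t l) 0 (max t q.2) u
      · exact Or.inl hs
      · rw [h]
        refine Or.inr (htour _ u ?_)
        simp only [situationAt, List.mem_append, List.mem_filter, List.mem_singleton,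
          decide_eq_true_eq]
        rw [List.mem_append] at hu
        tauto
    · rw [h]
      rcases hu with hu | rfl
      · rcases H.covered_rest geo (le_max_left t q.2) u hu with h₁ | h₁
        · exact Or.inl h₁
        · exact Or.inr (mem_extendedTour (Or.inr h₁))
      · exact Or.inr (mem_extendedTour (Or.inl rfl))
  last := by
    rcases replan_eq o tsp (situationAt geo pred p t l seen q) with h | ⟨h', h⟩
    · rw [h, planLast_tour]
    · rw [h]
      refine (planLast_extendedTour h' (situationAt geo pred p t l seen q)).trans ?_
      simp only [situationAt]
      rw [splice_of_ge geo p l (le_max_left _ _), planLast_planRest, H.last]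

/-- At time `T`, which is not before `B`, a server moving along `F` is in the origin and has served
the requests `S`. -/
def Finishes (o : X) (B : ℝ) (F : ℝ → X) (S : List (Req X)) (T : ℝ) : Prop :=
  B ≤ T ∧ F T = o ∧ ∀ u ∈ S, ServedIn F 0 T u

theorem PlanInv.finishes (H : PlanInv o pred B seen p t l) :
    Finishes o B (splice geo p t l) (pred ++ seen) (planEnd (p t) t l) := by
  have ht : t ≤ planEnd (p t) t l := le_planEnd _ _ _
  have h₀ : 0 ≤ t := H.budget_nonneg.trans H.budget_le
  refine ⟨H.budget_le.trans ht, ?_, fun u hu => ?_⟩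
  · rw [splice_of_ge geo p l ht, planPos_of_planEnd_le geo _ l le_rfl, H.last]
  · rcases H.covered u hu with h | h
    · exact servedIn_mono ((servedIn_congr fun s hs => splice_of_le geo p l hs).2 h) ht
    · obtain ⟨s, h₁, h₂, h₃, h₄⟩ := exists_served_of_mem geo (p t) t h
      exact ⟨s, h₀.trans h₁, h₂, h₃, by rw [splice_of_ge geo p l h₁, h₄]⟩

/-- The server left `o` no earlier than `B`. This bounds the way back to `o` whenever a tour is
recomputed. -/
theorem PlanInv.dist_pos_le (H : PlanInv o pred B seen p t l) {r : ℝ} (hr : t ≤ r) :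
    dist (splice geo p t l r) o ≤ r - B := by
  have := dist_le_of_lipschitz (lipschitz_splice geo H.lipschitz t l) (H.budget_le.trans hr)
  rwa [splice_of_le geo p l H.budget_le, H.home, dist_comm] at this

theorem unserved_situationAt_subset {S R : List (Req X)} {q : Req X} (hseen : ∀ u ∈ seen, u ∈ S)
    (hR : ∀ u ∈ q :: R, u ∈ S) :
    ∀ u ∈ (situationAt geo pred p t l seen q).unserved, u ∈ pred ∨ u ∈ S := by
  intro u hu
  simp only [situationAt, List.mem_append, List.mem_filter, List.mem_singleton] at hu
  rcases hu with ⟨hu | hu, -⟩ | rfl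
  · exact Or.inl hu
  · exact Or.inr (hseen u hu)
  · exact Or.inr (hR u (List.mem_cons_self ..))

/-- Robustness: phase (iii) does not last longer than its last tour through all unserved
requests. -/
theorem exists_finishes_le_of_tours (htour : ∀ U, ∀ u ∈ U, u ∈ tour o tsp U) {S : List (Req X)}
    {K : ℝ}
    (hK : ∀ U x t', (∀ u ∈ U, u ∈ pred ∨ u ∈ S) → B ≤ t' → (t' = B ∨ ∃ q ∈ S, t' = q.2) →
      dist x o ≤ t' - B → planEnd x t' (tour o tsp U) ≤ K)
    (R : List (Req X)) (H : PlanInv o pred B seen p t l) (hseen : ∀ u ∈ seen, u ∈ S)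
    (hR : ∀ u ∈ R, u ∈ S) (ht : t = B ∨ ∃ q ∈ S, t = q.2) (hl : planEnd (p t) t l ≤ K) :
    ∃ T ≤ K, Finishes o B (predictReplan geo o tsp pred p t l seen R).1 (pred ++ (seen ++ R)) T := by
  induction R generalizing p t l seen with
  | nil => exact ⟨_, hl, by rw [List.append_nil]; exact H.finishes geo⟩
  | cons q R ih =>
    have hq : q ∈ S := hR q (List.mem_cons_self ..)
    have ht' : max t q.2 = B ∨ ∃ q' ∈ S, max t q.2 = q'.2 := by
      rcases max_choice t q.2 with h | h <;> rw [h]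
      · exact ht
      · exact Or.inr ⟨q, hq, rfl⟩
    obtain ⟨T, hT, hT'⟩ := ih (seen := seen ++ [q]) (H.step geo htour q) (by
        intro u hu
        rcases List.mem_append.1 hu with hu | hu
        · exact hseen u hu
        · rwa [List.mem_singleton.1 hu])
      (fun u hu => hR u (List.mem_cons_of_mem _ hu)) ht'
      -- The comparison with `T₂` bounds the new plan without reference to the old one, so nothing
      -- accumulates.
      ((planEnd_replan_le_tour o tsp _).trans
        (hK _ _ _ (unserved_situationAt_subset geo hseen hR)
          (le_max_of_le_left H.budget_le) ht' (H.dist_pos_le geo (le_max_left _ _))))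
    exact ⟨T, hT, by rw [predictReplan_cons]; simpa using hT'⟩

/-- Smoothness: after the start of phase (iii), each unexpected request `q` prolongs it by at most
twice the cost of covering `q`. -/
theorem exists_finishes_le_of_excursions (htour : ∀ U, ∀ u ∈ U, u ∈ tour o tsp U)
    {S : List (Req X)} {K K₀ : ℝ} {m : Req X → ℝ} (hm₀ : ∀ q ∈ S, 0 ≤ m q)
    (hm : ∀ q ∈ S, ∃ h, pred.argmin (excursionCost q) = some h ∧ excursionCost q h ≤ m q)
    (hK₀ : ∀ U, (∀ u ∈ U, u ∈ pred ∨ u ∈ S) → planEnd o B (tour o tsp U) ≤ K₀)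
    (R : List (Req X)) (H : PlanInv o pred B seen p t l) (hseen : ∀ u ∈ seen, u ∈ S)
    (hR : ∀ u ∈ R, u ∈ S) (hsort : R.Pairwise (fun q q' => q.2 ≤ q'.2))
    (ht : t = B ∨ ∀ q ∈ R, t ≤ q.2) (hKK : K₀ ≤ K) (hSK : ∀ q ∈ S, q.2 ≤ K)
    (hl : planEnd (p t) t l ≤ K) :
    ∃ T ≤ K + (R.map fun q => 2 * m q).sum,
      Finishes o B (predictReplan geo o tsp pred p t l seen R).1 (pred ++ (seen ++ R)) T := by
  induction R generalizing p t l seen K with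
  | nil => exact ⟨_, by simpa using hl, by rw [List.append_nil]; exact H.finishes geo⟩
  | cons q R ih =>
    have hq : q ∈ S := hR q (List.mem_cons_self ..)
    have hmq := hm₀ q hq
    rw [List.pairwise_cons] at hsort
    set c := situationAt geo pred p t l seen q with hc
    have hnew : planEnd c.pos c.now (replan o tsp c) ≤ K + 2 * m q ∧
        (max t q.2 = B ∨ ∀ q' ∈ R, max t q.2 ≤ q'.2) := by
      rcases le_or_gt t q.2 with htq | htq
      · refine ⟨?_, Or.inr fun q' hq' => by rw [max_eq_right htq]; exact hsort.1 q' hq'⟩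
        obtain ⟨h, hh, hhm⟩ := hm q hq
        refine (planEnd_replan_le_extendedTour o tsp (c := c) hh).trans ?_
        -- The current tour may be over before `q` is released; therefore `K` must also dominate
        -- `q.2`.
        have hrest : planEnd c.pos c.now c.rest ≤ K := by
          have := planEnd_planRest geo (p t) htq l
          simp only [hc, situationAt, max_eq_right htq]
          rw [splice_of_ge geo p l htq, this]
          exact max_le (hSK q hq) hl
        have hnow : c.now = q.2 := max_eq_right htq
        have hcov := H.covered_rest geo (le_max_left t q.2) h
          (List.mem_append_left _ (List.argmin_mem hh))
        unfold extendedTour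
        split_ifs with hmem
        · exact (planEnd_insertExcursion_le _ _ _ _ _).trans
            (add_le_add hrest (le_trans (b := m q) hhm (by linarith)))
        -- Here `h` has been served at some `s ≥ h.2`. Since then the server has moved at most `q.2
        -- - h.2` away from `h.1`, so its distance to `q.1` is at most `excursionCost q h`. The way
        -- there and back is the source of the factor 2.
        · obtain ⟨s, -, h₂, h₃, h₄⟩ := hcov.resolve_right hmem
          have hd₁ := dist_le_of_lipschitz (lipschitz_splice geo H.lipschitz t l) h₂
          rw [h₄] at hd₁
          have hd₂ := dist_triangle c.pos h.1 q.1
          have hd₃ : dist h.1 c.pos ≤ max t q.2 - s := hd₁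
          rw [max_eq_right htq] at hd₃
          have hcost : dist c.pos q.1 ≤ excursionCost q h := by
            unfold excursionCost
            rw [dist_comm q.1 h.1]
            rw [dist_comm h.1 c.pos] at hd₃
            linarith [le_max_right (dist h.1 q.1) (q.2 - h.2)]
          have h0 : 0 ≤ c.now := by
            rw [hnow]
            exact (H.budget_nonneg.trans H.budget_le).trans htq
          refine (planEnd_deviation_le c.pos h0 (q := c.new) hnow.ge c.rest).trans ?_
          have : dist c.pos c.new.1 ≤ m q := hcost.trans hhm
          linarith
      -- A request released before phase (iii) is inserted at time `B` in the origin, where the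
      -- bound `K₀` for `T₂` applies without surcharge.
      · have htB : t = B := ht.resolve_right fun h =>
          absurd (h q (List.mem_cons_self ..)) (not_le.2 htq)
        have hmax : max t q.2 = B := by rw [max_eq_left htq.le, htB]
        refine ⟨?_, Or.inl hmax⟩
        refine (planEnd_replan_le_tour o tsp c).trans ?_
        have hpos : c.pos = o := by
          simp only [hc, situationAt, hmax]
          rw [splice_of_le geo p l H.budget_le, H.home]
        have hnow : c.now = B := hmax
        rw [hpos, hnow]
        linarith [hK₀ _ (unserved_situationAt_subset geo (p := p) (t := t) (l := l) hseen hR)]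
    obtain ⟨T, hT, hT'⟩ := ih (seen := seen ++ [q]) (K := K + 2 * m q) (H.step geo htour q) (by
        intro u hu
        rcases List.mem_append.1 hu with hu | hu
        · exact hseen u hu
        · rwa [List.mem_singleton.1 hu])
      (fun u hu => hR u (List.mem_cons_of_mem _ hu)) hsort.2 hnew.2 (by linarith)
      (fun u hu => (hSK u hu).trans (by linarith)) hnew.1
    refine ⟨T, ?_, by rw [predictReplan_cons]; simpa using hT'⟩
    rw [List.map_cons, List.sum_cons]
    linarith

end Replanning

/-! ### The algorithm is an online algorithm -/

section AlgoGen

variable (o : X) (tsp : X × List X → List X) (A : List (Req X) → List (Req X)) (α : ℝ≥0)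

open Classical in
theorem algoGen_eq (pred R : List (Req X)) :
    algoGen geo o tsp A α pred R =
      predictReplan geo o tsp pred
        (homePos geo o (onlinePos geo o A R) (α * tourLength o tsp pred))
        (α * tourLength o tsp pred) (tour o tsp pred) []
        (R.filter (fun q => q ∉ pred ∧
          ¬ ServedIn (homePos geo o (onlinePos geo o A R) (α * tourLength o tsp pred)) 0
            (α * tourLength o tsp pred) q)) := rfl

theorem budget_nonneg (pred : List (Req X)) : 0 ≤ (α : ℝ) * tourLength o tsp pred :=
  mul_nonneg α.coe_nonneg (tourLength_nonneg o tsp pred)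

/-- The budget `B` depends only on the prediction. Up to `B` the trajectory is `homePos`, which is
causal. After `B`, the list of pending requests is selected by the trajectory up to `B`, which later
releases do not affect. -/
theorem isOnline_algoGen (pred : List (Req X)) :
    IsOnline o (fun R => (algoGen geo o tsp A α pred R).1) := by
  classical
  have hB := budget_nonneg o tsp α pred
  set B := (α : ℝ) * tourLength o tsp pred
  refine ⟨fun R hR => ⟨?_, ?_⟩, fun R R' t hR ht => ?_⟩
  · obtain ⟨h₁, -⟩ := phaseOneEnd_mem (lipschitz_onlinePos geo A o R) (onlinePos_zero geo A o hR) hB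
    beta_reduce
    rw [algoGen_eq, predictReplan_of_le geo _ _ _ _ _ _ _ hB, homePos, splice_of_le geo _ _ h₁,
      onlinePos_zero geo A o hR]
  · exact lipschitz_predictReplan geo _ _ _
      (lipschitz_splice geo (lipschitz_onlinePos geo A o R) _ _) _ _ _ _
  · have hR₀ : IsInstance R := ⟨⟨hR.1.1.of_append_left,
      fun q hq => hR.1.2 q (List.mem_append_left _ hq)⟩, (List.pairwise_append.1 hR.2).1⟩
    have hA : ∀ s ≤ t, onlinePos geo o A (R ++ R') s = onlinePos geo o A R s := fun s hs =>
      onlineRun_append geo A _ [] R R' hR.2 fun q hq => hs.trans_lt (ht q hq)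
    have hp := homePos_congr geo (lipschitz_onlinePos geo A o _) (lipschitz_onlinePos geo A o _)
      (onlinePos_zero geo A o hR) (onlinePos_zero geo A o hR₀) hB hA
    beta_reduce
    rw [algoGen_eq, algoGen_eq]
    rcases le_or_gt t B with htB | htB
    · rw [predictReplan_of_le geo _ _ _ _ _ _ _ htB, predictReplan_of_le geo _ _ _ _ _ _ _ htB,
        hp t le_rfl]
    · have hp' := fun s (hs : s ≤ B) => hp s (hs.trans htB.le)
      rw [List.filter_append, predictReplan_append _ _ _ _ _ _ _ _ _
        fun q hq => ht q (List.mem_of_mem_filter hq), predictReplan_congr geo o tsp pred hp']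
      refine congrArg (fun L => (predictReplan geo o tsp pred _ B _ [] L).1 t)
        (List.filter_congr fun q _ => ?_)
      rw [decide_eq_decide, servedIn_congr hp']

end AlgoGen

end Trajectories

/-! ### The competitive ratio -/

section Bounds

variable {X : Type} [MetricSpace X]

open Classical in
theorem mem_reqSet {X : Type} {l : List (Req X)} {q : Req X} : q ∈ reqSet l ↔ q ∈ l :=
  List.mem_toFinset

theorem makespan_le {X : Type} {o : X} {p : ℝ → X} {R : List (Req X)} {T : ℝ} (hT : 0 ≤ T) (h : p T = o)
    (hR : ∀ q ∈ R, ServedIn p 0 T q) : makespan o p R ≤ ENNReal.ofReal T := by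
  refine iInf_le_of_le ⟨⟨T, hT⟩, h, hR⟩ ?_
  rw [ENNReal.ofReal, Real.toNNReal_of_nonneg hT]
  exact le_rfl

theorem release_le_makespan {X : Type} {o : X} {p : ℝ → X} {R : List (Req X)} {q : Req X} (hq : q ∈ R) :
    ENNReal.ofReal q.2 ≤ makespan o p R := by
  refine le_iInf ?_
  rintro ⟨T, -, hR⟩
  obtain ⟨s, -, hs, hs', -⟩ := hR q hq
  exact (ENNReal.ofReal_le_ofReal (hs'.trans hs)).trans (by rw [ENNReal.ofReal_coe_nnreal])

variable (geo : ShortestPaths X) (o : X) {ν ρ α : ℝ≥0} (tsp : X × List X → List X)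
  (A : List (Req X) → List (Req X))

/-- Either the algorithm is done when `A` is, or `A` exceeds the time budget. -/
theorem makespan_algoGen_le_or (α : ℝ≥0) (pred R : List (Req X)) :
    makespan o (algoGen geo o tsp A α pred R).1 R ≤ makespan o (onlinePos geo o A R) R ∨
      ENNReal.ofReal (α * tourLength o tsp pred) ≤ makespan o (onlinePos geo o A R) R := by
  have hB := budget_nonneg o tsp α pred
  have key : ∀ T : ℝ≥0, onlinePos geo o A R T = o → (∀ q ∈ R, ServedIn (onlinePos geo o A R) 0 T q) →
      (T : ℝ) ≤ α * tourLength o tsp pred →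
      makespan o (algoGen geo o tsp A α pred R).1 R ≤ T := by
    intro T hT hTR hTB
    -- At time `T` the server is in `o`, so within the budget phase (i) cannot have ended before.
    have hτ : (T : ℝ) ≤ phaseOneEnd o (onlinePos geo o A R) (α * tourLength o tsp pred) :=
      le_phaseOneEnd T.2 (by rw [hT, dist_self, sub_zero]; exact hTB)
    have hF : ∀ s ≤ (T : ℝ), (algoGen geo o tsp A α pred R).1 s = onlinePos geo o A R s := by
      intro s hs
      rw [algoGen_eq, predictReplan_of_le geo _ _ _ _ _ _ _ (hs.trans hTB), homePos,
        splice_of_le geo _ _ (hs.trans hτ)]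
    rw [← ENNReal.ofReal_coe_nnreal]
    exact makespan_le T.2 (by rw [hF _ le_rfl, hT])
      fun q hq => (servedIn_congr hF).2 (hTR q hq)
  -- The makespan is an infimum that is not known to be attained, so the distinction is made on
  -- finishing times within the budget.
  by_cases hex : ∃ T : ℝ≥0, onlinePos geo o A R T = o ∧
      (∀ q ∈ R, ServedIn (onlinePos geo o A R) 0 T q) ∧ (T : ℝ) ≤ α * tourLength o tsp pred
  · obtain ⟨T₀, h₁, h₂, h₃⟩ := hex
    left
    refine le_iInf ?_
    rintro ⟨T, hT, hTR⟩
    rcases le_total T T₀ with h | h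
    · exact key T hT hTR ((NNReal.coe_le_coe.2 h).trans h₃)
    · exact (key T₀ h₁ h₂ h₃).trans (ENNReal.coe_le_coe.2 h)
  · right
    push Not at hex
    refine le_iInf ?_
    rintro ⟨T, hT, hTR⟩
    exact (ENNReal.ofReal_le_ofReal (hex T hT hTR).le).trans (by rw [ENNReal.ofReal_coe_nnreal])

theorem planInv_homePos (htsp : IsTSPApprox ν tsp) (pred : List (Req X)) {R : List (Req X)}
    (hR : IsInstance R) :
    PlanInv o pred (α * tourLength o tsp pred) []
      (homePos geo o (onlinePos geo o A R) (α * tourLength o tsp pred))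
      (α * tourLength o tsp pred) (tour o tsp pred) where
  lipschitz := lipschitz_splice geo (lipschitz_onlinePos geo A o R) _ _
  budget_nonneg := budget_nonneg o tsp α pred
  budget_le := le_rfl
  home := homePos_budget geo (lipschitz_onlinePos geo A o R) (onlinePos_zero geo A o hR)
    (budget_nonneg o tsp α pred)
  covered := by
    intro u hu
    rw [List.append_nil] at hu
    exact Or.inr (List.mem_append_left _ ((mem_tourStops o htsp pred u).2 hu))
  last := planLast_tour o _ tsp pred

theorem planEnd_homePos_le {pred R : List (Req X)} (hR : IsInstance R) :
    planEnd (homePos geo o (onlinePos geo o A R) (α * tourLength o tsp pred)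
        (α * tourLength o tsp pred)) (α * tourLength o tsp pred) (tour o tsp pred) ≤
      tourLength o tsp pred + α * tourLength o tsp pred := by
  have hB := budget_nonneg o tsp α pred
  rw [homePos_budget geo (lipschitz_onlinePos geo A o R) (onlinePos_zero geo A o hR) hB]
  have := planEnd_add_le o 0 hB (tour o tsp pred)
  rwa [zero_add] at this

open Classical in
/-- The unexpected requests that are to be served in phase (iii). -/
def pendingRequests (α : ℝ≥0) (pred R : List (Req X)) : List (Req X) :=
  R.filter (fun q => q ∉ pred ∧
    ¬ ServedIn (homePos geo o (onlinePos geo o A R) (α * tourLength o tsp pred)) 0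
      (α * tourLength o tsp pred) q)

theorem makespan_le_of_finishes {pred R : List (Req X)} {T : ℝ}
    (h : Finishes o (α * tourLength o tsp pred) (algoGen geo o tsp A α pred R).1
      (pred ++ ([] ++ pendingRequests geo o tsp A α pred R)) T) :
    makespan o (algoGen geo o tsp A α pred R).1 R ≤ ENNReal.ofReal T := by
  obtain ⟨h₁, h₂, h₃⟩ := h
  refine makespan_le ((budget_nonneg o tsp α pred).trans h₁) h₂ fun q hq => ?_
  by_cases hs : ServedIn (homePos geo o (onlinePos geo o A R) (α * tourLength o tsp pred)) 0
      (α * tourLength o tsp pred) q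
  · refine servedIn_mono ((servedIn_congr fun s hs => ?_).2 hs) h₁
    rw [algoGen_eq, predictReplan_of_le geo _ _ _ _ _ _ _ hs]
  · refine h₃ q ?_
    simp only [pendingRequests, List.nil_append, List.mem_append, List.mem_filter,
      decide_eq_true_eq]
    tauto

theorem release_le_toReal {R : List (Req X)} (hC : optMakespan (reqSet R) (o, 0) ≠ ⊤) {q : Req X}
    (hq : q ∈ R) : q.2 ≤ (optMakespan (reqSet R) (o, 0)).toReal := by
  have := release_le_optMakespan (mem_reqSet.2 hq) (o, 0)
  rw [ENNReal.ofReal_zero, zero_add] at this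
  exact (ENNReal.ofReal_le_iff_le_toReal hC).1 this

theorem points_subset {X : Type} {pred R U : List (Req X)} (hU : ∀ u ∈ U, u ∈ pred ∨ u ∈ R) :
    {z | z ∈ U.map Prod.fst} ⊆
      {z | z ∈ pred.map Prod.fst} ∪ Prod.fst '' (reqSet R : Set (Req X)) := by
  intro z hz
  obtain ⟨u, hu, rfl⟩ := List.mem_map.1 hz
  rcases hU u hu with h | h
  · exact Or.inl (List.mem_map_of_mem h)
  · exact Or.inr ⟨u, mem_reqSet.2 h, rfl⟩

variable {o tsp A}

/-- Robustness. -/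
theorem makespan_algoGen_le_robust (hα : 0 < α) (htsp : IsTSPApprox ν tsp)
    (hA : IsCompetitive geo o ρ A) {pred R : List (Req X)} (hR : IsInstance R) :
    makespan o (algoGen geo o tsp A α pred R).1 R ≤
      ((ρ : ℝ≥0∞) + (1 + (ν : ℝ≥0∞)) * (1 + (ρ : ℝ≥0∞) / (α : ℝ≥0∞))) *
        optMakespan (reqSet R) (o, 0) := by
  have hα' : (α : ℝ≥0∞) ≠ 0 := by exact_mod_cast hα.ne'
  have hdiv : (ρ : ℝ≥0∞) / (α : ℝ≥0∞) ≠ ⊤ := ENNReal.div_ne_top ENNReal.coe_ne_top hα'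
  rcases makespan_algoGen_le_or geo o tsp A α pred R with h | h
  · exact (h.trans (hA R hR)).trans (mul_le_mul_left le_self_add _)
  by_cases hC : optMakespan (reqSet R) (o, 0) = ⊤
  · rw [hC, ENNReal.mul_top]
    · exact le_top
    · refine (lt_of_lt_of_le ?_ le_add_self).ne'
      exact ENNReal.mul_pos (by simp) (by simp)
  -- This follows from the competitiveness of `A`, which has to serve `q`, rather than from `1 ≤ ρ`.
  have hrel : ∀ q ∈ R, q.2 ≤ ρ * (optMakespan (reqSet R) (o, 0)).toReal := by
    intro q hq
    have := (release_le_makespan (o := o) (p := onlinePos geo o A R) hq).trans (hA R hR)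
    rw [ENNReal.ofReal_le_iff_le_toReal (ENNReal.mul_ne_top ENNReal.coe_ne_top hC)] at this
    simpa using this
  have hBC : α * tourLength o tsp pred ≤ ρ * (optMakespan (reqSet R) (o, 0)).toReal := by
    have := h.trans (hA R hR)
    rw [ENNReal.ofReal_le_iff_le_toReal (ENNReal.mul_ne_top ENNReal.coe_ne_top hC)] at this
    simpa using this
  have hrel' : ∀ q ∈ R, q.2 ≤ (optMakespan (reqSet R) (o, 0)).toReal :=
    fun q hq => release_le_toReal o hC hq
  have hwalk := coverWalk_le_optMakespan (reqSet R) (o, 0)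
  have hC' : optMakespan (reqSet R) (o, 0) =
      ENNReal.ofReal (optMakespan (reqSet R) (o, 0)).toReal := (ENNReal.ofReal_toReal hC).symm
  set C := optMakespan (reqSet R) (o, 0)
  set c := C.toReal with hc
  have hc₀ : 0 ≤ c := ENNReal.toReal_nonneg
  set D := tourLength o tsp pred with hD
  have hD₀ : 0 ≤ D := tourLength_nonneg o tsp pred
  have hB₀ : 0 ≤ (α : ℝ) * D := mul_nonneg α.coe_nonneg hD₀
  have hν₀ := ν.coe_nonneg
  have hK : ∀ U x t', (∀ u ∈ U, u ∈ pred ∨ u ∈ R) → α * D ≤ t' →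
      (t' = α * D ∨ ∃ q ∈ R, t' = q.2) → dist x o ≤ t' - α * D →
      planEnd x t' (tour o tsp U) ≤ ρ * c + (1 + ν) * (c + D) := by
    intro U x t' hU _ ht' hd
    refine (planEnd_tour_le o x (M := c + D) (L := c + D) (by positivity) U ?_ htsp ?_
      (by positivity)).trans ?_
    · intro u hu
      rcases hU u hu with h | h
      · linarith [release_le_tourLength o htsp h]
      · linarith [hrel' u h]
    -- The predicted tour and an optimal tour for `R` are joined in `o`.
    · refine (coverWalk_mono (points_subset hU) o).trans
        ((coverWalk_union_le (Or.inr rfl)).trans ?_)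
      rw [add_comm c, ENNReal.ofReal_add hD₀ hc₀, ← hC']
      exact add_le_add (coverWalk_le_tourLength o htsp pred) hwalk
    -- At a release time `t'`, the sum `t' + dist x o` is at most `2t' - αD`; one `t'` is bounded by
    -- `ρ * c` and the other by `c`.
    · have : max (t' + dist x o) (c + D) ≤ ρ * c + (c + D) := by
        have h₀ : 0 ≤ (ρ : ℝ) * c := mul_nonneg ρ.coe_nonneg hc₀
        refine max_le ?_ (by linarith)
        rcases ht' with rfl | ⟨q, hq, rfl⟩
        · linarith
        · linarith [hrel q hq, hrel' q hq]
      linarith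
  obtain ⟨T, hT, hfin⟩ := exists_finishes_le_of_tours geo
    (fun U u hu => List.mem_append_left _ ((mem_tourStops o htsp U u).2 hu)) hK
    (pendingRequests geo o tsp A α pred R) (planInv_homePos geo o tsp A (α := α) htsp pred hR)
    (by simp) (fun u hu => List.mem_of_mem_filter hu) (Or.inl rfl)
    ((planEnd_homePos_le geo o tsp A hR).trans (by
      have : 0 ≤ ν * (c + D) := by positivity
      linarith))
  refine (makespan_le_of_finishes geo o tsp A hfin).trans (ENNReal.ofReal_le_of_le_toReal ?_)
  rw [ENNReal.toReal_mul, ENNReal.toReal_add ENNReal.coe_ne_top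
    (ENNReal.mul_ne_top (by simp) (by simp [hdiv])), ENNReal.toReal_mul,
    ENNReal.toReal_add ENNReal.one_ne_top ENNReal.coe_ne_top,
    ENNReal.toReal_add ENNReal.one_ne_top hdiv, ENNReal.toReal_div]
  simp only [ENNReal.coe_toReal, ENNReal.toReal_one]
  refine hT.trans ?_
  have hα₀ : (0 : ℝ) < α := by exact_mod_cast hα
  have hDc : D ≤ ρ / α * c := by
    rw [div_mul_eq_mul_div, le_div_iff₀ hα₀]
    linarith
  calc ρ * c + (1 + ν) * (c + D) ≤ ρ * c + (1 + ν) * (c + ρ / α * c) := by gcongr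
    _ = _ := by ring

open Classical in
/-- Consistency and smoothness. -/
theorem makespan_algoGen_le_smooth (hν : 1 ≤ ν) (htsp : IsTSPApprox ν tsp)
    {pred R : List (Req X)} (hR : IsInstance R)
    (hC₀ : optMakespan (reqSet R) (o, 0) ≠ 0) (hC : optMakespan (reqSet R) (o, 0) ≠ ⊤) :
    makespan o (algoGen geo o tsp A α pred R).1 R ≤
      (1 + (ν : ℝ≥0∞)) * (1 + (α : ℝ≥0∞)) *
        (1 + 3 * coverError 1 (reqSet R) (reqSet pred) /
          (2 * optMakespan (reqSet R) (o, 0))) * optMakespan (reqSet R) (o, 0) := by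
  -- As the optimum is finite and nonzero, an infinite error makes the bound infinite.
  by_cases hΛ : coverError 1 (reqSet R) (reqSet pred) = ⊤
  · refine le_top.trans_eq (Eq.symm ?_)
    rw [hΛ, ENNReal.mul_top (by norm_num), ENNReal.top_div_of_ne_top
      (ENNReal.mul_ne_top (by norm_num) hC), add_top, ENNReal.mul_top, ENNReal.top_mul hC₀]
    exact (ENNReal.mul_pos (by simp) (by simp)).ne'
  have hrel' : ∀ q ∈ R, q.2 ≤ (optMakespan (reqSet R) (o, 0)).toReal :=
    fun q hq => release_le_toReal o hC hq
  have hΛ' := hΛ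
  unfold coverError at hΛ'
  rw [ENNReal.add_eq_top, not_or] at hΛ'
  obtain ⟨hG, hG₁⟩ := hΛ'
  have hwalk := coverWalk_union_le_coverCost (k := ⊤) (reqSet pred) (reqSet R) o
  have hrelG : ∀ q ∈ pred, q.2 ≤ (optMakespan (reqSet R) (o, 0)).toReal +
      (coverCost ⊤ (reqSet pred) (reqSet R)).toReal := by
    intro q hq
    have := release_le_coverCost (k := ⊤) (B := reqSet R) (C := optMakespan (reqSet R) (o, 0))
      (fun b hb => by
        simpa using release_le_optMakespan hb (o, 0)) (mem_reqSet.2 hq)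
    rw [ENNReal.ofReal_le_iff_le_toReal (ENNReal.add_ne_top.2 ⟨hC, hG⟩),
      ENNReal.toReal_add hC hG] at this
    exact this
  -- Without predictions, a nonempty `R` has no cover, and the error would be infinite.
  have harg : ∀ q ∈ R, ∃ h, pred.argmin (excursionCost q) = some h := by
    intro q hq
    cases hh : pred.argmin (excursionCost q) with
    | some h => exact ⟨h, rfl⟩
    | none =>
      rw [List.argmin_eq_none] at hh
      subst hh
      have : IsEmpty {H : Finset (Finset (Req X) × Req X) //
          IsCover 1 (reqSet R) (reqSet []) H} := ?_
      · exact absurd (iInf_of_empty _) hG₁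
      refine ⟨fun H => ?_⟩
      obtain ⟨e, he, -⟩ := H.2.2 q (mem_reqSet.2 hq)
      have := (H.2.1 e he).2.2
      simp [reqSet] at this
  choose! h hh using harg
  have hsum : ((R.map fun q => 2 * excursionCost q (h q)).sum : ℝ) ≤
      2 * (coverCost 1 (reqSet R) (reqSet pred)).toReal := by
    have h₁ := sum_le_coverCost_one geo (A := reqSet R) (B := reqSet pred)
      (m := fun q => excursionCost q (h q)) (fun a ha b hb =>
        List.le_of_mem_argmin (mem_reqSet.1 hb) (hh a (mem_reqSet.1 ha)))
    rw [← ENNReal.ofReal_sum_of_nonneg fun q _ => excursionCost_nonneg q (h q),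
      ENNReal.ofReal_le_iff_le_toReal hG₁] at h₁
    rw [List.sum_map_mul_left]
    refine mul_le_mul_of_nonneg_left (le_trans (le_of_eq ?_) h₁) zero_le_two
    exact (List.sum_toFinset _ hR.1.1).symm
  set C := optMakespan (reqSet R) (o, 0)
  set c := C.toReal with hc
  set G := coverCost ⊤ (reqSet pred) (reqSet R)
  set g := G.toReal with hg
  have hc₀ : 0 ≤ c := ENNReal.toReal_nonneg
  have hg₀ : 0 ≤ g := ENNReal.toReal_nonneg
  have hν₀ := ν.coe_nonneg
  have hα₀ := α.coe_nonneg
  -- The quantity `c + g` bounds both the releases and the closed walk; the former gives the 1 and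
  -- the latter the `ν` in `1 + ν`.
  have htour : ∀ (U : List (Req X)) (t' : ℝ), (∀ u ∈ U, u ∈ pred ∨ u ∈ R) → 0 ≤ t' →
      planEnd o t' (tour o tsp U) ≤ t' + (1 + ν) * (c + g) := by
    intro U t' hU ht'
    refine (planEnd_tour_le o o (M := c + g) (L := c + g) (by positivity) U ?_ htsp ?_
      (by positivity)).trans ?_
    · intro u hu
      rcases hU u hu with h | h
      · exact hrelG u h
      · linarith [hrel' u h]
    · refine (coverWalk_mono (points_subset hU) o).trans ((coverWalk_mono ?_ o).trans
        (hwalk.trans_eq ?_))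
      · rintro z (hz | hz)
        · obtain ⟨u, hu, rfl⟩ := List.mem_map.1 hz
          exact Or.inr ⟨u, mem_reqSet.2 hu, rfl⟩
        · exact Or.inl hz
      · rw [ENNReal.ofReal_add hc₀ hg₀, hc, hg, ENNReal.ofReal_toReal hC, ENNReal.ofReal_toReal hG]
    · rw [dist_self, add_zero]
      have : max t' (c + g) ≤ t' + (c + g) := max_le (by linarith) (by linarith)
      linarith
  set D := tourLength o tsp pred with hD
  have hD₀ : 0 ≤ D := tourLength_nonneg o tsp pred
  have hD₁ : D ≤ (1 + ν) * (c + g) := by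
    have := htour pred 0 (fun u hu => Or.inl hu) le_rfl
    rwa [zero_add] at this
  have hαD : α * D ≤ α * ((1 + ν) * (c + g)) := by gcongr
  -- This `K` dominates the end `(1 + α) * D` of the predicted tour and the end of every tour that
  -- starts in `o` at the budget `α * D`.
  obtain ⟨T, hT, hfin⟩ := exists_finishes_le_of_excursions geo (K := (1 + α) * ((1 + ν) * (c + g)))
    (fun U u hu => List.mem_append_left _ ((mem_tourStops o htsp U u).2 hu))
    (m := fun q => excursionCost q (h q)) (fun q _ => excursionCost_nonneg q (h q))
    (fun q hq => ⟨h q, hh q hq, le_rfl⟩)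
    (fun U hU => htour U (α * D) hU (mul_nonneg hα₀ hD₀))
    (pendingRequests geo o tsp A α pred R) (planInv_homePos geo o tsp A (α := α) htsp pred hR)
    (by simp) (fun u hu => List.mem_of_mem_filter hu) (hR.2.sublist List.filter_sublist)
    (Or.inl rfl) (by linarith) (by
      intro q hq
      have h₁ := hrel' q hq
      have h₂ : 0 ≤ (1 + α) * ((1 + ν) * g) := by positivity
      have h₃ : 0 ≤ α * ((1 + ν) * c) := by positivity
      have h₄ : 0 ≤ ν * c := by positivity
      linarith)
    ((planEnd_homePos_le geo o tsp A hR).trans (by linarith))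
  refine (makespan_le_of_finishes geo o tsp A hfin).trans (ENNReal.ofReal_le_of_le_toReal ?_)
  have hC2 : 2 * C ≠ 0 := mul_ne_zero two_ne_zero hC₀
  have hq : 3 * coverError 1 (reqSet R) (reqSet pred) / (2 * C) ≠ ⊤ :=
    ENNReal.div_ne_top (ENNReal.mul_ne_top (by norm_num) hΛ) hC2
  rw [ENNReal.toReal_mul, ENNReal.toReal_mul, ENNReal.toReal_mul,
    ENNReal.toReal_add ENNReal.one_ne_top ENNReal.coe_ne_top,
    ENNReal.toReal_add ENNReal.one_ne_top ENNReal.coe_ne_top,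
    ENNReal.toReal_add ENNReal.one_ne_top hq, ENNReal.toReal_div, ENNReal.toReal_mul,
    ENNReal.toReal_mul]
  unfold coverError
  rw [ENNReal.toReal_add hG hG₁]
  simp only [ENNReal.coe_toReal, ENNReal.toReal_one, ENNReal.toReal_ofNat]
  set g₁ := (coverCost 1 (reqSet R) (reqSet pred)).toReal with hg₁
  have hg₁₀ : 0 ≤ g₁ := ENNReal.toReal_nonneg
  have hcpos : 0 < c := ENNReal.toReal_pos hC₀ hC
  have hT' : T ≤ (1 + α) * ((1 + ν) * (c + g)) + 2 * g₁ := by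
    refine hT.trans (add_le_add_right (le_trans ?_ hsum) _)
    refine List.Sublist.sum_le_sum (List.filter_sublist.map _) ?_
    intro r hr
    obtain ⟨q, -, rfl⟩ := List.mem_map.1 hr
    exact mul_nonneg zero_le_two (excursionCost_nonneg q (h q))
  have hν₁ : (1 : ℝ) ≤ ν := by exact_mod_cast hν
  -- Here `1 ≤ ν` enters. It yields the bound `(1 + ν) * (1 + α) * (c + g + g₁)`, and the constant
  -- 3/2 leaves slack, which `h₂` accounts for.
  have h₁ : 2 * g₁ ≤ (1 + ν) * (1 + α) * g₁ := by
    refine mul_le_mul_of_nonneg_right ?_ hg₁₀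
    have : 0 ≤ (1 + (ν : ℝ)) * α := by positivity
    linarith
  have h₂ : 0 ≤ (1 + ν) * (1 + α) * (g + g₁) := by positivity
  have e : (1 + ν) * (1 + α) * (1 + 3 * (g + g₁) / (2 * c)) * c =
      (1 + ν) * (1 + α) * c + 3 / 2 * ((1 + ν) * (1 + α) * (g + g₁)) := by
    field_simp
  rw [e]
  linarith

theorem makespan_algoGen_le (hν : 1 ≤ ν) (hα : 0 < α) (htsp : IsTSPApprox ν tsp)
    (hA : IsCompetitive geo o ρ A) {pred R : List (Req X)} (hR : IsInstance R) :
    makespan o (algoGen geo o tsp A α pred R).1 R ≤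
      min
        ((1 + (ν : ℝ≥0∞)) * (1 + (α : ℝ≥0∞)) *
          (1 + 3 * coverError 1 (reqSet R) (reqSet pred) /
            (2 * optMakespan (reqSet R) (o, 0))))
        ((ρ : ℝ≥0∞) + (1 + (ν : ℝ≥0∞)) * (1 + (ρ : ℝ≥0∞) / (α : ℝ≥0∞)))
      * optMakespan (reqSet R) (o, 0) := by
  have hrob := makespan_algoGen_le_robust (pred := pred) geo hα htsp hA hR
  rw [(mul_left_mono (α := ℝ≥0∞)).map_min]
  refine le_min ?_ hrob
  -- Both bounds are then 0, whatever the value of the quotient, and robustness gives the claim.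
  by_cases hC₀ : optMakespan (reqSet R) (o, 0) = 0
  · rw [hC₀, mul_zero] at hrob ⊢
    exact hrob
  by_cases hC : optMakespan (reqSet R) (o, 0) = ⊤
  · rw [hC, ENNReal.mul_top]
    · exact le_top
    · exact (ENNReal.mul_pos (ENNReal.mul_pos (by simp) (by simp)).ne' (by simp)).ne'
  exact makespan_algoGen_le_smooth geo hν htsp hR hC₀ hC

end Bounds

/-! ### Polynomial bounds -/

section PolyBounds

/-- `c` is bounded by a polynomial in `s`. -/
def PolyBounded {α : Type} (s c : α → ℕ) : Prop := ∃ P : Polynomial ℕ, ∀ x, c x ≤ P.eval (s x)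

theorem polynomial_eval_mono (P : Polynomial ℕ) : Monotone fun n : ℕ => P.eval n := by
  intro m n h
  simp only [Polynomial.eval_eq_sum_range]
  gcongr

variable {α β : Type} {s c d : α → ℕ}

theorem PolyBounded.mono (h : PolyBounded s c) (hd : ∀ x, d x ≤ c x) : PolyBounded s d :=
  let ⟨P, hP⟩ := h
  ⟨P, fun x => (hd x).trans (hP x)⟩

theorem PolyBounded.const (s : α → ℕ) (k : ℕ) : PolyBounded s fun _ => k :=
  ⟨Polynomial.C k, fun _ => by simp⟩

theorem PolyBounded.self (s : α → ℕ) : PolyBounded s s := ⟨Polynomial.X, fun _ => by simp⟩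

theorem PolyBounded.add (hc : PolyBounded s c) (hd : PolyBounded s d) :
    PolyBounded s fun x => c x + d x := by
  obtain ⟨P, hP⟩ := hc
  obtain ⟨Q, hQ⟩ := hd
  exact ⟨P + Q, fun x => by rw [Polynomial.eval_add]; exact add_le_add (hP x) (hQ x)⟩

theorem PolyBounded.mul (hc : PolyBounded s c) (hd : PolyBounded s d) :
    PolyBounded s fun x => c x * d x := by
  obtain ⟨P, hP⟩ := hc
  obtain ⟨Q, hQ⟩ := hd
  exact ⟨P * Q, fun x => by rw [Polynomial.eval_mul]; exact Nat.mul_le_mul (hP x) (hQ x)⟩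

theorem PolyBounded.eval (hc : PolyBounded s c) (Q : Polynomial ℕ) :
    PolyBounded s fun x => Q.eval (c x) := by
  obtain ⟨P, hP⟩ := hc
  exact ⟨Q.comp P, fun x => by
    rw [Polynomial.eval_comp]; exact polynomial_eval_mono Q (hP x)⟩

theorem PolyBounded.comp {s' c' : β → ℕ} (hc : PolyBounded s' c') (f : α → β)
    (hf : PolyBounded s fun x => s' (f x)) : PolyBounded s fun x => c' (f x) := by
  obtain ⟨Q, hQ⟩ := hc
  exact (hf.eval Q).mono fun x => hQ (f x)

end PolyBounds

/-! ### Programs that run in polynomial time -/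

section Programs

variable {X : Type} [MetricSpace X] {geo : ShortestPaths X}

/-- The invariant `I` allows the bound `k` to depend on a part of the state that the loop leaves
unchanged. -/
theorem foldCost_le {α β : Type} {f : β × α → β} {c : β × α → ℕ} (I : β → Prop) {k : ℕ}
    (hI : ∀ b a, I b → I (f (b, a))) (hc : ∀ b a, I b → c (b, a) ≤ k) {b : β} (hb : I b)
    (l : List α) : foldCost f c b l ≤ l.length * (k + 1) + 1 := by
  induction l generalizing b with
  | nil => simp [foldCost]
  | cons a l ih =>
    have h₁ := hc b a hb
    have h₂ := ih (hI b a hb)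
    simp only [foldCost, List.length_cons]
    linarith

namespace PolyTime

variable {Z α β γ : Type} {s : Z → ℕ}

theorem of_const {f : Z → α} {k : ℕ} (h : Computes geo f fun _ => k) : PolyTime geo s f :=
  ⟨_, h, PolyBounded.const s k⟩

protected theorem id : PolyTime geo s fun x => x := of_const .id

/-- The cost of `g` is measured in the size of the intermediate result, so this size needs a
polynomial bound of its own. -/
theorem comp {s' : α → ℕ} {f : Z → α} {g : α → β} (hg : PolyTime geo s' g)
    (hf : PolyTime geo s f) (h : PolyBounded s fun x => s' (f x)) :
    PolyTime geo s fun x => g (f x) := by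
  obtain ⟨c, hc, hcP⟩ := hf
  obtain ⟨d, hd, hdP⟩ := hg
  exact ⟨_, .comp hc hd, (PolyBounded.add hcP (PolyBounded.comp hdP f h)).add (.const s 1)⟩

theorem comp_const {f : Z → α} {g : α → β} {k : ℕ} (hg : Computes geo g fun _ => k)
    (hf : PolyTime geo s f) : PolyTime geo s fun x => g (f x) :=
  comp (of_const (s := fun _ => 0) hg) hf (.const s 0)

theorem pair {f : Z → α} {g : Z → β} (hf : PolyTime geo s f) (hg : PolyTime geo s g) :
    PolyTime geo s fun x => (f x, g x) := by
  obtain ⟨c, hc, hcP⟩ := hf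
  obtain ⟨d, hd, hdP⟩ := hg
  exact ⟨_, .pair hc hd, (PolyBounded.add hcP hdP).add (.const s 1)⟩

theorem fst {f : Z → α × β} (hf : PolyTime geo s f) : PolyTime geo s fun x => (f x).1 :=
  comp_const .fst hf

theorem snd {f : Z → α × β} (hf : PolyTime geo s f) : PolyTime geo s fun x => (f x).2 :=
  comp_const .snd hf

theorem bool (b : Bool) : PolyTime geo s fun _ => b := of_const (.bool b)

theorem real (r : ℝ) : PolyTime geo s fun _ => r := of_const (.real r)

theorem point (x : X) : PolyTime geo s fun _ => x := of_const (.point x)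

theorem nil : PolyTime geo s fun _ => ([] : List α) := of_const .nil

theorem cons {f : Z → α} {l : Z → List α} (hf : PolyTime geo s f) (hl : PolyTime geo s l) :
    PolyTime geo s fun x => f x :: l x :=
  comp_const .cons (hf.pair hl)

theorem add {f g : Z → ℝ} (hf : PolyTime geo s f) (hg : PolyTime geo s g) :
    PolyTime geo s fun x => f x + g x :=
  comp_const .add (hf.pair hg)

theorem sub {f g : Z → ℝ} (hf : PolyTime geo s f) (hg : PolyTime geo s g) :
    PolyTime geo s fun x => f x - g x :=
  comp_const .sub (hf.pair hg)

theorem mul {f g : Z → ℝ} (hf : PolyTime geo s f) (hg : PolyTime geo s g) :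
    PolyTime geo s fun x => f x * g x :=
  comp_const .mul (hf.pair hg)

theorem dist {f g : Z → X} (hf : PolyTime geo s f) (hg : PolyTime geo s g) :
    PolyTime geo s fun x => dist (f x) (g x) :=
  comp_const .metric (hf.pair hg)

theorem cond {b : Z → Bool} {f g : Z → α} (hb : PolyTime geo s b) (hf : PolyTime geo s f)
    (hg : PolyTime geo s g) : PolyTime geo s fun x => if b x then f x else g x := by
  obtain ⟨e, he, heP⟩ := hb
  obtain ⟨c, hc, hcP⟩ := hf
  obtain ⟨d, hd, hdP⟩ := hg
  refine ⟨_, .cond he hc hd, ((PolyBounded.add heP (.add hcP hdP)).add (.const s 1)).mono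
    fun x => ?_⟩
  split_ifs <;> omega

/-- A decision procedure for `p` that runs in polynomial time. -/
def Decides (geo : ShortestPaths X) (s : Z → ℕ) (p : Z → Prop) : Prop :=
  ∃ b : Z → Bool, PolyTime geo s b ∧ ∀ x, b x = true ↔ p x

theorem ite {p : Z → Prop} [∀ x, Decidable (p x)] {f g : Z → α} (hp : Decides geo s p)
    (hf : PolyTime geo s f) (hg : PolyTime geo s g) :
    PolyTime geo s fun x => if p x then f x else g x := by
  obtain ⟨b, hb, hbp⟩ := hp
  convert hb.cond hf hg using 4 with x
  exact (hbp x).symm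

theorem decide {p : Z → Prop} [∀ x, Decidable (p x)] (hp : Decides geo s p) :
    PolyTime geo s fun x => decide (p x) := by
  obtain ⟨b, hb, hbp⟩ := hp
  convert hb using 2 with x
  rw [Bool.eq_iff_iff, decide_eq_true_iff, hbp]

namespace Decides

theorem congr {p q : Z → Prop} (hp : Decides geo s p) (h : ∀ x, p x ↔ q x) : Decides geo s q :=
  let ⟨b, hb, hbp⟩ := hp
  ⟨b, hb, fun x => (hbp x).trans (h x)⟩

theorem le {f g : Z → ℝ} (hf : PolyTime geo s f) (hg : PolyTime geo s g) :
    Decides geo s fun x => f x ≤ g x := by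
  classical
  exact ⟨_, comp_const .le (hf.pair hg), fun x => by simp⟩

theorem not {p : Z → Prop} (hp : Decides geo s p) : Decides geo s fun x => ¬ p x := by
  obtain ⟨b, hb, hbp⟩ := hp
  refine ⟨_, hb.cond (bool false) (bool true), fun x => ?_⟩
  beta_reduce
  rw [← hbp x]
  cases b x <;> simp

theorem and {p q : Z → Prop} (hp : Decides geo s p) (hq : Decides geo s q) :
    Decides geo s fun x => p x ∧ q x := by
  obtain ⟨b, hb, hbp⟩ := hp
  obtain ⟨d, hd, hdq⟩ := hq
  refine ⟨_, hb.cond hd (bool false), fun x => ?_⟩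
  beta_reduce
  rw [← hbp x, ← hdq x]
  cases b x <;> simp

theorem lt {f g : Z → ℝ} (hf : PolyTime geo s f) (hg : PolyTime geo s g) :
    Decides geo s fun x => f x < g x :=
  (le hg hf).not.congr fun _ => not_le

theorem eq_real {f g : Z → ℝ} (hf : PolyTime geo s f) (hg : PolyTime geo s g) :
    Decides geo s fun x => f x = g x :=
  ((le hf hg).and (le hg hf)).congr fun _ => le_antisymm_iff.symm

/-- Equality of points is not an elementary operation; it is tested by means of the metric. -/
theorem eq_point {f g : Z → X} (hf : PolyTime geo s f) (hg : PolyTime geo s g) :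
    Decides geo s fun x => f x = g x :=
  (le (hf.dist hg) (real 0)).congr fun _ => dist_le_zero

theorem eq_req {f g : Z → Req X} (hf : PolyTime geo s f) (hg : PolyTime geo s g) :
    Decides geo s fun x => f x = g x :=
  ((eq_point hf.fst hg.fst).and (eq_real hf.snd hg.snd)).congr fun _ => Prod.ext_iff.symm

end Decides

theorem max {f g : Z → ℝ} (hf : PolyTime geo s f) (hg : PolyTime geo s g) :
    PolyTime geo s fun x => max (f x) (g x) := by
  simp only [max_def]
  exact ite (.le hf hg) hg hf

/-- A loop whose body may refer to the input of the whole program, with a number of iterations and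
a running time of the body that are polynomial in the size of this input. -/
theorem foldl {f : (Z × β) × α → β} {i : Z → β} {l : Z → List α}
    (hf : PolyTime geo (fun z : (Z × β) × α => s z.1.1) f) (hi : PolyTime geo s i)
    (hl : PolyTime geo s l) (hlen : PolyBounded s fun x => (l x).length) :
    PolyTime geo s fun x => (l x).foldl (fun b a => f ((x, b), a)) (i x) := by
  -- The body of a loop sees only the state and the list element, so the input is carried along in
  -- the state. The cost of the body is bounded in terms of this copy alone; the growth of the
  -- accumulator is irrelevant.
  have hstep : PolyTime geo (fun z : (Z × β) × α => s z.1.1)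
      (fun z : (Z × β) × α => (z.1.1, f z)) := PolyTime.id.fst.fst.pair hf
  obtain ⟨c, hc, P, hP⟩ := hstep
  have hloop : PolyTime geo (fun z : (Z × β) × List α => s z.1.1 + z.2.length)
      (fun z : (Z × β) × List α => z.2.foldl (fun b a => (b.1, f (b, a))) z.1) := by
    refine ⟨_, .fold hc, Polynomial.X * (P + 1) + 1, fun z => ?_⟩
    have h := foldCost_le (f := fun z : (Z × β) × α => (z.1.1, f z)) (c := c)
      (fun b => b.1 = z.1.1) (k := P.eval (s z.1.1)) (fun b a hb => hb) (fun b a hb => by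
        have : c (b, a) ≤ P.eval (s b.1) := hP (b, a)
        rwa [hb] at this) rfl z.2 (b := z.1)
    refine h.trans ?_
    simp only [Polynomial.eval_add, Polynomial.eval_mul, Polynomial.eval_X, Polynomial.eval_one]
    gcongr
    · omega
    · exact polynomial_eval_mono P (Nat.le_add_right _ _)
  have := (comp hloop ((PolyTime.id.pair hi).pair hl) ((PolyBounded.self s).add hlen)).snd
  convert this using 2 with x
  generalize l x = l'
  generalize i x = b
  induction l' generalizing b with
  | nil => rfl
  | cons a l' ih => exact ih _

theorem reverse {l : Z → List α} (hl : PolyTime geo s l)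
    (hlen : PolyBounded s fun x => (l x).length) : PolyTime geo s fun x => (l x).reverse := by
  have := foldl (geo := geo) (s := s) (f := fun z : (Z × List α) × α => z.2 :: z.1.2)
    (i := fun _ => []) (PolyTime.id.snd.cons PolyTime.id.fst.snd) .nil hl hlen
  convert this using 2 with x
  have key : ∀ m acc : List α, m.foldl (fun b a => a :: b) acc = m.reverse ++ acc := by
    intro m
    induction m with
    | nil => exact fun _ => rfl
    | cons a m ih => exact fun acc => by rw [List.foldl_cons, ih, List.reverse_cons, List.append_assoc]; rfl
  exact ((key (l x) []).trans (List.append_nil _)).symm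

theorem foldr {f : (Z × β) × α → β} {i : Z → β} {l : Z → List α}
    (hf : PolyTime geo (fun z : (Z × β) × α => s z.1.1) f) (hi : PolyTime geo s i)
    (hl : PolyTime geo s l) (hlen : PolyBounded s fun x => (l x).length) :
    PolyTime geo s fun x => (l x).foldr (fun a b => f ((x, b), a)) (i x) := by
  have := foldl hf hi (hl.reverse hlen) (by simpa only [List.length_reverse] using hlen)
  simpa only [List.foldl_reverse] using this

theorem append {l l' : Z → List α} (hl : PolyTime geo s l) (hl' : PolyTime geo s l')
    (hlen : PolyBounded s fun x => (l x).length) : PolyTime geo s fun x => l x ++ l' x := by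
  have := foldr (geo := geo) (s := s) (f := fun z : (Z × List α) × α => z.2 :: z.1.2)
    (PolyTime.id.snd.cons PolyTime.id.fst.snd) hl' hl hlen
  convert this using 2 with x
  generalize l x = m
  induction m with
  | nil => rfl
  | cons a m ih => rw [List.foldr_cons, ← ih]; rfl

theorem map {f : Z × α → β} {l : Z → List α} (hf : PolyTime geo (fun z : Z × α => s z.1) f)
    (hl : PolyTime geo s l) (hlen : PolyBounded s fun x => (l x).length) :
    PolyTime geo s fun x => (l x).map fun a => f (x, a) := by
  have := foldr (geo := geo) (s := s) (f := fun z : (Z × List β) × α => f (z.1.1, z.2) :: z.1.2)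
    ((comp hf (PolyTime.id.fst.fst.pair PolyTime.id.snd) (.self _)).cons PolyTime.id.fst.snd)
    .nil hl hlen
  convert this using 2 with x
  generalize l x = m
  induction m with
  | nil => rfl
  | cons a m ih => rw [List.foldr_cons, ← ih]; rfl

theorem filter {p : Z × α → Prop} [∀ z, Decidable (p z)] {l : Z → List α}
    (hp : Decides geo (fun z : Z × α => s z.1) p) (hl : PolyTime geo s l)
    (hlen : PolyBounded s fun x => (l x).length) :
    PolyTime geo s fun x => (l x).filter fun a => p (x, a) := by
  obtain ⟨b, hb, hbp⟩ := hp
  have hb' : PolyTime geo (fun z : (Z × List α) × α => s z.1.1)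
      (fun z : (Z × List α) × α => b (z.1.1, z.2)) :=
    comp hb (PolyTime.id.fst.fst.pair PolyTime.id.snd) (.self _)
  have := foldr (geo := geo) (s := s)
    (f := fun z : (Z × List α) × α => if b (z.1.1, z.2) then z.2 :: z.1.2 else z.1.2)
    (hb'.cond (PolyTime.id.snd.cons PolyTime.id.fst.snd) PolyTime.id.fst.snd) .nil hl hlen
  convert this using 2 with x
  generalize l x = m
  induction m with
  | nil => rfl
  | cons a m ih =>
    rw [List.foldr_cons, ← ih]
    simp only [List.filter_cons, decide_eq_true_eq, hbp]

theorem flatMap {f : Z × α → List β} {l : Z → List α}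
    (hf : PolyTime geo (fun z : Z × α => s z.1) f)
    (hflen : PolyBounded (fun z : Z × α => s z.1) fun z => (f z).length) (hl : PolyTime geo s l)
    (hlen : PolyBounded s fun x => (l x).length) :
    PolyTime geo s fun x => (l x).flatMap fun a => f (x, a) := by
  have := foldr (geo := geo) (s := s) (f := fun z : (Z × List β) × α => f (z.1.1, z.2) ++ z.1.2)
    ((comp hf (PolyTime.id.fst.fst.pair PolyTime.id.snd) (.self _)).append PolyTime.id.fst.snd
      (hflen.comp (fun z : (Z × List β) × α => (z.1.1, z.2)) (.self _)))
    .nil hl hlen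
  convert this using 2 with x
  generalize l x = m
  induction m with
  | nil => rfl
  | cons a m ih => rw [List.foldr_cons, ← ih]; rfl

theorem listCase {f : Z → γ} {g : Z × β × List β → γ} {l : Z → List β} (hf : PolyTime geo s f)
    (hg : PolyTime geo (fun z : Z × β × List β => s z.1) g) (hl : PolyTime geo s l) :
    PolyTime geo s fun x => match l x with | [] => f x | b :: l' => g (x, b, l') := by
  obtain ⟨c, hc, hcP⟩ := hf
  obtain ⟨d, hd, Q, hQ⟩ := hg
  have hcase : PolyTime geo (fun z : Z × List β => s z.1)
      (fun z : Z × List β => match z.2 with | [] => f z.1 | b :: l' => g (z.1, b, l')) := by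
    obtain ⟨P, hP⟩ := hcP
    refine ⟨_, .listCase hc hd, P + Q + 1, ?_⟩
    rintro ⟨x, _ | ⟨b, l'⟩⟩
    · have : c x ≤ P.eval (s x) := hP x
      simp only [Polynomial.eval_add, Polynomial.eval_one]
      omega
    · have : d (x, b, l') ≤ Q.eval (s x) := hQ (x, b, l')
      simp only [Polynomial.eval_add, Polynomial.eval_one]
      omega
  exact comp hcase (PolyTime.id.pair hl) (.self s)

theorem mem {q : Z → Req X} {l : Z → List (Req X)} (hq : PolyTime geo s q)
    (hl : PolyTime geo s l) (hlen : PolyBounded s fun x => (l x).length) :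
    Decides geo s fun x => q x ∈ l x := by
  classical
  have hq' : PolyTime geo (fun z : (Z × Bool) × Req X => s z.1.1)
      (fun z : (Z × Bool) × Req X => q z.1.1) := comp hq PolyTime.id.fst.fst (.self _)
  refine ⟨_, foldr (geo := geo) (s := s)
    (f := fun z : (Z × Bool) × Req X => if q z.1.1 = z.2 then true else z.1.2)
    (ite (.eq_req hq' PolyTime.id.snd) (bool true) PolyTime.id.fst.snd) (bool false) hl hlen,
    fun x => ?_⟩
  beta_reduce
  generalize l x = m
  induction m with
  | nil => simp
  | cons a m ih =>
    rw [List.foldr_cons, List.mem_cons, ← ih]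
    split_ifs with h
    · simp [h]
    · simp only [h, false_or]

/-! ### The subroutines of the algorithm -/

theorem planEnd {x : Z → X} {t : Z → ℝ} {l : Z → List (Req X)} (hx : PolyTime geo s x)
    (ht : PolyTime geo s t) (hl : PolyTime geo s l) (hlen : PolyBounded s fun z => (l z).length) :
    PolyTime geo s fun z => planEnd (x z) (t z) (l z) := by
  have := (foldl (geo := geo) (s := s)
    (f := fun z : (Z × X × ℝ) × Req X =>
      (z.2.1, Max.max (z.1.2.2 + Dist.dist z.1.2.1 z.2.1) z.2.2))
    (PolyTime.id.snd.fst.pair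
      (max (add PolyTime.id.fst.snd.snd (dist PolyTime.id.fst.snd.fst PolyTime.id.snd.fst))
        PolyTime.id.snd.snd)) (hx.pair ht) hl hlen).snd
  convert this using 2 with z
  generalize l z = m
  generalize x z = y
  generalize t z = r
  induction m generalizing y r with
  | nil => rfl
  | cons a m ih => exact ih _ _

theorem excursionCost {q h : Z → Req X} (hq : PolyTime geo s q) (hh : PolyTime geo s h) :
    PolyTime geo s fun x => excursionCost (q x) (h x) :=
  add (max (dist hh.fst hq.fst) (sub hq.snd hh.snd)) (dist hq.fst hh.fst)

/-- The list is processed from its end. The state keeps the plain suffix beside the result, because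
a visit of `h` found further to the front discards an excursion inserted behind it. -/
theorem insertExcursion {h q : Z → Req X} {l : Z → List (Req X)} (hh : PolyTime geo s h)
    (hq : PolyTime geo s q) (hl : PolyTime geo s l)
    (hlen : PolyBounded s fun z => (l z).length) :
    PolyTime geo s fun z => insertExcursion (h z) (q z) (l z) := by
  classical
  have lift {f : Z → Req X} (hf : PolyTime geo s f) :
      PolyTime geo (fun z : (Z × List (Req X) × List (Req X)) × Req X => s z.1.1)
        (fun z : (Z × List (Req X) × List (Req X)) × Req X => f z.1.1) :=
    comp hf PolyTime.id.fst.fst (.self _)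
  have := (foldr (geo := geo) (s := s)
    (f := fun z : (Z × List (Req X) × List (Req X)) × Req X =>
      (z.2 :: z.1.2.1, if z.2 = h z.1.1 then h z.1.1 :: q z.1.1 :: h z.1.1 :: z.1.2.1
        else z.2 :: z.1.2.2))
    ((PolyTime.id.snd.cons PolyTime.id.fst.snd.fst).pair
      (ite (.eq_req PolyTime.id.snd (lift hh))
        ((lift hh).cons ((lift hq).cons ((lift hh).cons PolyTime.id.fst.snd.fst)))
        (PolyTime.id.snd.cons PolyTime.id.fst.snd.snd)))
    (PolyTime.pair .nil .nil) hl hlen).snd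
  convert this using 2 with z
  generalize l z = m
  have key : ∀ m : List (Req X), m.foldr (fun a b => (a :: b.1,
      if a = h z then h z :: q z :: h z :: b.1 else a :: b.2)) (([] : List (Req X)), []) =
      (m, OLTSP.insertExcursion (h z) (q z) m) := by
    intro m
    induction m with
    | nil => rfl
    | cons a m ih =>
      rw [List.foldr_cons, ih]
      simp only [OLTSP.insertExcursion]
  rw [key]

/-- The optional minimizer is encoded as a list with at most one element, on which programs can make
a case distinction. The loop replaces the candidate only by a strictly better one, as `List.argmin`
does. -/
theorem argmin {f : Z × Req X → ℝ} {l : Z → List (Req X)}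
    (hf : PolyTime geo (fun z : Z × Req X => s z.1) f) (hl : PolyTime geo s l)
    (hlen : PolyBounded s fun z => (l z).length) :
    PolyTime geo s fun z => ((l z).argmin fun a => f (z, a)).toList := by
  classical
  have hcmp : PolyTime geo
      (fun z : ((Z × List (Req X)) × Req X) × Req X × List (Req X) => s z.1.1.1)
      (fun z : ((Z × List (Req X)) × Req X) × Req X × List (Req X) =>
        if f (z.1.1.1, z.1.2) < f (z.1.1.1, z.2.1) then [z.1.2] else [z.2.1]) :=
    ite (.lt (comp hf (PolyTime.id.fst.fst.fst.pair PolyTime.id.fst.snd) (.self _))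
      (comp hf (PolyTime.id.fst.fst.fst.pair PolyTime.id.snd.fst) (.self _)))
      (PolyTime.id.fst.snd.cons .nil) (PolyTime.id.snd.fst.cons .nil)
  have := foldl (geo := geo) (s := s)
    (listCase (Z := (Z × List (Req X)) × Req X) (f := fun z => [z.2])
      (PolyTime.id.snd.cons .nil) hcmp PolyTime.id.fst.snd) .nil hl hlen
  convert this using 2 with z
  generalize l z = m
  induction m using List.reverseRecOn with
  | nil => rfl
  | append_singleton m a ih =>
    rw [List.argmin_concat, List.foldl_append, List.foldl_cons, List.foldl_nil, ← ih]
    cases List.argmin (fun a => f (z, a)) m with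
    | none => rfl
    | some c =>
      simp only [Option.toList_some]
      split_ifs <;> rfl

variable {tsp : X × List X → List X}

-- A point with several requests may occur several times in the TSP order and then contributes all
-- its requests each time; hence the quadratic bound.
open Classical in
theorem length_tour_le {ν : ℝ≥0} (htsp : IsTSPApprox ν tsp) (o : X) (U : List (Req X)) :
    (tour o tsp U).length ≤ U.length * U.length + 1 := by
  have h : ∀ l : List X, (l.flatMap fun x => U.filter fun q => q.1 = x).length ≤
      l.length * U.length := by
    intro l
    induction l with
    | nil => simp
    | cons a l ih =>
      have := U.length_filter_le fun q => q.1 = a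
      rw [List.flatMap_cons, List.length_append, List.length_cons, Nat.succ_mul]
      omega
  have := h (tsp (o, U.map Prod.fst))
  rw [(htsp o _).1.length_eq, List.length_map] at this
  rw [tour_eq, List.length_append]
  exact Nat.add_le_add_right this 1

theorem tour {ν : ℝ≥0} (htsp : IsTSPApprox ν tsp)
    (htspPoly : PolyTime geo (fun z : X × List X => z.2.length) tsp) (o : X)
    {U : Z → List (Req X)} (hU : PolyTime geo s U)
    (hlen : PolyBounded s fun z => (U z).length) :
    PolyTime geo s fun z => tour o tsp (U z) := by
  classical
  have hpts : PolyTime geo s fun z => (U z).map Prod.fst :=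
    map (f := fun z : Z × Req X => z.2.1) PolyTime.id.snd.fst hU hlen
  have htsp' : PolyTime geo s fun z => tsp (o, (U z).map Prod.fst) :=
    comp htspPoly ((point o).pair hpts) (hlen.mono fun z => by simp)
  have hlen' : PolyBounded s fun z => (tsp (o, (U z).map Prod.fst)).length :=
    hlen.mono fun z => by rw [(htsp o _).1.length_eq, List.length_map]
  have hfilter : PolyTime geo (fun z : Z × X => s z.1)
      (fun z : Z × X => (U z.1).filter fun q => q.1 = z.2) :=
    filter (p := fun w : (Z × X) × Req X => w.2.1 = w.1.2)
      (.eq_point PolyTime.id.snd.fst PolyTime.id.fst.snd)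
      (comp hU PolyTime.id.fst (.self _)) (hlen.comp Prod.fst (.self _))
  have hstops : PolyTime geo s fun z => tourStops o tsp (U z) :=
    flatMap hfilter ((hlen.comp (α := Z × X) Prod.fst (.self _)).mono
      fun z => List.length_filter_le _ _) htsp' hlen'
  refine append hstops ((point o |>.pair (real 0)).cons .nil)
    (((hlen.mul hlen).add (.const s 1)).mono fun z => ?_)
  refine le_trans ?_ (length_tour_le htsp o (U z))
  rw [tour_eq, List.length_append]
  exact Nat.le_add_right _ _

end PolyTime

end Programs

/-! ### Running time of the subroutines and of all their calls -/

section RunningTime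

variable {X : Type} [MetricSpace X] {geo : ShortestPaths X} {ν : ℝ≥0} {tsp : X × List X → List X}
  (o : X)

theorem length_extendedTour_le {X : Type} (h : Req X) (c : Situation X) :
    (extendedTour h c).length ≤ c.rest.length + 2 := by
  unfold extendedTour
  split_ifs
  · exact length_insertExcursion_le _ _ _
  · simp

/-- The size of a situation as an input of a program. -/
def situationSize {X : Type}
    (z : List (Req X) × List (Req X) × List (Req X) × ℝ × X × Req X) : ℕ :=
  z.1.length + z.2.1.length + z.2.2.1.length

theorem polyTime_replan (htsp : IsTSPApprox ν tsp)
    (htspPoly : PolyTime geo (fun z : X × List X => z.2.length) tsp) :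
    PolyTime geo situationSize fun z => replan o tsp (Situation.ofInput z) := by
  classical
  have hpred : PolyBounded (situationSize (X := X)) fun z => z.1.length :=
    (PolyBounded.self _).mono fun z => by unfold situationSize; omega
  have huns : PolyBounded (situationSize (X := X)) fun z => z.2.1.length :=
    (PolyBounded.self _).mono fun z => by unfold situationSize; omega
  have hrest : PolyBounded (situationSize (X := X)) fun z => z.2.2.1.length :=
    (PolyBounded.self _).mono fun z => by unfold situationSize; omega
  have htour : PolyTime geo (situationSize (X := X)) fun z => tour o tsp z.2.1 :=
    PolyTime.tour htsp htspPoly o PolyTime.id.snd.fst huns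
  have htourlen : PolyBounded (situationSize (X := X)) fun z => (tour o tsp z.2.1).length :=
    ((huns.mul huns).add (.const _ 1)).mono fun z => PolyTime.length_tour_le htsp o z.2.1
  have hmin := PolyTime.argmin (geo := geo) (s := situationSize (X := X))
    (f := fun w => excursionCost w.1.2.2.2.2.2 w.2)
    (PolyTime.excursionCost PolyTime.id.fst.snd.snd.snd.snd.snd PolyTime.id.snd)
    PolyTime.id.fst hpred
  let s' : (List (Req X) × List (Req X) × List (Req X) × ℝ × X × Req X) × Req X ×
    List (Req X) → ℕ := fun z => situationSize z.1
  have hrest' : PolyBounded s' fun z => z.1.2.2.1.length := hrest.comp Prod.fst (.self _)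
  have htour' : PolyTime geo s' fun z => tour o tsp z.1.2.1 :=
    PolyTime.comp (f := Prod.fst) htour PolyTime.id.fst (.self _)
  have hext : PolyTime geo s' fun z => extendedTour z.2.1 (Situation.ofInput z.1) :=
    PolyTime.ite (PolyTime.mem PolyTime.id.snd.fst PolyTime.id.fst.snd.snd.fst hrest')
      (PolyTime.insertExcursion PolyTime.id.snd.fst PolyTime.id.fst.snd.snd.snd.snd.snd
        PolyTime.id.fst.snd.snd.fst hrest')
      (PolyTime.id.fst.snd.snd.snd.snd.snd.cons
        ((PolyTime.id.fst.snd.snd.snd.snd.fst.pair (.real 0)).cons PolyTime.id.fst.snd.snd.fst))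
  have hchoice : PolyTime geo s' fun z =>
      if planEnd z.1.2.2.2.2.1 z.1.2.2.2.1 (extendedTour z.2.1 (Situation.ofInput z.1)) ≤
          planEnd z.1.2.2.2.2.1 z.1.2.2.2.1 (tour o tsp z.1.2.1)
        then extendedTour z.2.1 (Situation.ofInput z.1) else tour o tsp z.1.2.1 :=
    PolyTime.ite
      (.le (PolyTime.planEnd PolyTime.id.fst.snd.snd.snd.snd.fst PolyTime.id.fst.snd.snd.snd.fst
          hext ((hrest'.add (.const _ 2)).mono fun z => length_extendedTour_le _ _))
        (PolyTime.planEnd PolyTime.id.fst.snd.snd.snd.snd.fst PolyTime.id.fst.snd.snd.snd.fst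
          htour' (htourlen.comp Prod.fst (.self _))))
      hext htour'
  convert PolyTime.listCase htour hchoice hmin using 2 with z
  cases hh : z.1.argmin (excursionCost z.2.2.2.2.2) with
  | none => exact replan_of_argmin_eq_none o tsp (c := Situation.ofInput z) hh
  | some h => exact replan_of_argmin o tsp (c := Situation.ofInput z) hh

theorem polyTime_tour_budget (htsp : IsTSPApprox ν tsp)
    (htspPoly : PolyTime geo (fun z : X × List X => z.2.length) tsp) (α : ℝ≥0) :
    PolyTime geo (fun U : List (Req X) => U.length)
      fun U => (tour o tsp U, (α : ℝ) * tourLength o tsp U) := by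
  have h := PolyTime.tour (s := fun U : List (Req X) => U.length) htsp htspPoly o PolyTime.id
    (.self _)
  exact h.pair ((PolyTime.real _).mul (PolyTime.planEnd (.point o) (.real 0) h
    ((((PolyBounded.self _).mul (.self _)).add (.const _ 1)).mono
      fun U => PolyTime.length_tour_le htsp o U)))

theorem length_replan_le (htsp : IsTSPApprox ν tsp) (c : Situation X) {M : ℕ}
    (h₁ : c.rest.length + 2 ≤ M) (h₂ : c.unserved.length * c.unserved.length + 1 ≤ M) :
    (replan o tsp c).length ≤ M := by
  rcases replan_eq o tsp c with h | ⟨h', h⟩ <;> rw [h]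
  · exact (PolyTime.length_tour_le htsp o _).trans h₂
  · exact (length_extendedTour_le _ _).trans h₁

theorem length_predictReplan (pred : List (Req X)) (p : ℝ → X) (t : ℝ) (l seen R : List (Req X)) :
    (predictReplan geo o tsp pred p t l seen R).2.length = R.length := by
  induction R generalizing p t l seen with
  | nil => rfl
  | cons q R ih =>
    rw [predictReplan_cons, List.length_cons, List.length_cons, ih]

/-- All situations are of polynomial size. -/
theorem situationSize_le (htsp : IsTSPApprox ν tsp) {pred : List (Req X)} {N : ℕ} (p : ℝ → X)
    (t : ℝ) (l seen R : List (Req X)) (hN : pred.length + (seen.length + R.length) ≤ N)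
    (hl : l.length ≤ N * N + 1 + 2 * seen.length) :
    ∀ c ∈ (predictReplan geo o tsp pred p t l seen R).2,
      situationSize c.toInput ≤ N + N + (N * N + 1 + 2 * N) := by
  induction R generalizing p t l seen with
  | nil => simp [predictReplan]
  | cons q R ih =>
    rw [List.length_cons] at hN
    set c := situationAt geo pred p t l seen q with hc
    have huns : c.unserved.length ≤ N := by
      simp only [hc, situationAt, List.length_append, List.length_singleton]
      refine (Nat.add_le_add_right (List.length_filter_le _ _) 1).trans ?_
      rw [List.length_append]
      omega
    have hrest : c.rest.length ≤ N * N + 1 + 2 * seen.length :=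
      (length_planRest_le _ _ _ _).trans hl
    rw [predictReplan_cons]
    intro c' hc'
    rcases List.mem_cons.1 hc' with rfl | hc'
    · change pred.length + c.unserved.length + c.rest.length ≤ _
      omega
    · refine ih _ _ _ (seen ++ [q]) ?_ ?_ c' hc'
      · rw [List.length_append, List.length_singleton]
        omega
      -- Replanning either adds at most two stops or starts a new tour with at most `N * N + 1`
      -- stops, which preserves the bound on `l`.
      · rw [List.length_append, List.length_singleton]
        have := Nat.mul_le_mul huns huns
        exact length_replan_le o htsp c (by omega) (by omega)

theorem algoGenPolyTime (htsp : IsTSPApprox ν tsp)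
    (htspPoly : PolyTime geo (fun z : X × List X => z.2.length) tsp)
    {A : List (Req X) → List (Req X)}
    (hAPoly : PolyTime geo (fun R : List (Req X) => R.length) A) (α : ℝ≥0) :
    AlgoGenPolyTime geo o tsp A α := by
  classical
  obtain ⟨cTour, hTour, P₁, hP₁⟩ := polyTime_tour_budget o htsp htspPoly α
  obtain ⟨cA, hA, P₂, hP₂⟩ := hAPoly
  obtain ⟨cTest, hTest, P₃, hP₃⟩ := PolyTime.decide
    (PolyTime.mem (geo := geo) (s := fun z : Req X × List (Req X) => z.2.length)
      PolyTime.id.fst PolyTime.id.snd (.self _))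
  obtain ⟨cReplan, hReplan, P₄, hP₄⟩ := polyTime_replan o htsp htspPoly
  -- The summands count one predicted tour, at most `N + 1` decisions of `A`, at most `N` tests and
  -- at most `N` replannings. The polynomial inside `P₄.comp` is the bound of `situationSize_le`.
  refine ⟨cTour, cA, cTest, cReplan, hTour, hA, by convert hTest, hReplan,
    P₁ + (Polynomial.X + 1) * P₂ + Polynomial.X * P₃ +
      Polynomial.X * P₄.comp (Polynomial.X + Polynomial.X +
        (Polynomial.X * Polynomial.X + 1 + 2 * Polynomial.X)), fun pred R _ _ => ?_⟩
  intro B τ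
  set N := pred.length + R.length with hN
  simp only [Polynomial.eval_add, Polynomial.eval_mul, Polynomial.eval_comp, Polynomial.eval_X,
    Polynomial.eval_one, Polynomial.eval_ofNat]
  refine Nat.add_le_add (Nat.add_le_add (Nat.add_le_add ?_ ?_) ?_) ?_
  · exact (hP₁ pred).trans (polynomial_eval_mono P₁ (Nat.le_add_right pred.length _))
  · refine (Finset.sum_le_card_nsmul _ _ (P₂.eval N) fun k _ => ?_).trans ?_
    · exact (hP₂ _).trans (polynomial_eval_mono P₂ ((List.length_take_le' _ _).trans (by omega)))
    · rw [Finset.card_range, smul_eq_mul]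
      have := R.length_filter_le fun q => q.2 ≤ τ
      exact Nat.mul_le_mul_right _ (by omega)
  · refine (List.sum_le_card_nsmul _ (P₃.eval N) fun k hk => ?_).trans ?_
    · obtain ⟨q, -, rfl⟩ := List.mem_map.1 hk
      exact (hP₃ _).trans (polynomial_eval_mono P₃ (Nat.le_add_right pred.length _))
    · rw [List.length_map, smul_eq_mul]
      exact Nat.mul_le_mul_right _ (by omega)
  · refine (List.sum_le_card_nsmul _ (P₄.eval (N + N + (N * N + 1 + 2 * N)))
      fun k hk => ?_).trans ?_
    · obtain ⟨c, hc, rfl⟩ := List.mem_map.1 hk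
      refine (hP₄ _).trans (polynomial_eval_mono P₄ ?_)
      rw [algoGen_eq] at hc
      refine situationSize_le o htsp _ _ _ _ _ ?_ ?_ c hc
      · have := List.length_filter_le (fun q => decide (q ∉ pred ∧
          ¬ ServedIn (homePos geo o (onlinePos geo o A R) (α * tourLength o tsp pred)) 0
            (α * tourLength o tsp pred) q)) R
        rw [List.length_nil]
        omega
      · refine (PolyTime.length_tour_le htsp o pred).trans ?_
        have : pred.length * pred.length ≤ N * N := Nat.mul_le_mul (by omega) (by omega)
        omega
    · rw [List.length_map, smul_eq_mul, algoGen_eq, length_predictReplan]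
      exact Nat.mul_le_mul_right _ ((List.length_filter_le _ _).trans (by omega))

end RunningTime

end OLTSP

end

theorem theorem6 {X : Type} [MetricSpace X] (geo : OLTSP.ShortestPaths X) (o : X)
    (ν ρ α : ℝ≥0) (hν : 1 ≤ ν) (hα : 0 < α)
    (tsp : X × List X → List X)
    (htsp : OLTSP.IsTSPApprox ν tsp)
    (htspPoly : OLTSP.PolyTime geo (fun z : X × List X => z.2.length) tsp)
    (A : List (OLTSP.Req X) → List (OLTSP.Req X))
    (hA : OLTSP.IsCompetitive geo o ρ A)
    (hAPoly : OLTSP.PolyTime geo (fun R : List (OLTSP.Req X) => R.length) A) :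
    (∀ pred, OLTSP.IsReqSet pred →
      OLTSP.IsOnline o (fun R => (OLTSP.algoGen geo o tsp A α pred R).1)) ∧
    (∀ pred R, OLTSP.IsReqSet pred → OLTSP.IsInstance R →
      OLTSP.makespan o (OLTSP.algoGen geo o tsp A α pred R).1 R ≤
        min
          ((1 + (ν : ℝ≥0∞)) * (1 + (α : ℝ≥0∞)) *
            (1 + 3 * OLTSP.coverError 1 (OLTSP.reqSet R) (OLTSP.reqSet pred) /
              (2 * OLTSP.optMakespan (OLTSP.reqSet R) (o, 0))))
          ((ρ : ℝ≥0∞) + (1 + (ν : ℝ≥0∞)) * (1 + (ρ : ℝ≥0∞) / (α : ℝ≥0∞)))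
        * OLTSP.optMakespan (OLTSP.reqSet R) (o, 0)) ∧
    OLTSP.AlgoGenPolyTime geo o tsp A α :=
  ⟨fun pred _ => OLTSP.isOnline_algoGen geo o tsp A α pred,
    fun _ _ _ hR => OLTSP.makespan_algoGen_le geo hν hα htsp hA hR,
    OLTSP.algoGenPolyTime o htsp htspPoly hAPoly α⟩
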